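/- **Setting.** Let $d\ge 3$, $M\ge 1$ and $T>\max\{M,2\}$ be integers, let $\mathcal D\subset\{x\in\mathbb R^d:\|x\|_2\le 1\}$ be a nonempty finite action set, and let $\theta^*\in\mathbb R^d$ with $\|\theta^*\|_2\le 1$ be unknown. At each time step $t=1,\dots,T$ each agent $i=1,\dots,M$ chooses $x_{t,i}\in\mathcal D$ and observes $y_{t,i}=\langle x_{t,i},\theta^*\rangle+\eta_{t,i}$, where the $\eta_{t,i}$ are independent, have mean zero and take values in $[-1,1]$. The regret is $REG(T)=\sum_{t=1}^T\sum_{i=1}^M\bigl(\max_{x\in\mathcal D}\langle x,\theta^*\rangle-\langle x_{t,i},\theta^*\rangle\bigr)$. Between time steps the agents communicate with a server, without delay, in packets that each contain one integer or one real number; the communication cost is the number of packets exchanged. **The DELB protocol.** Put $A_1=\mathcal D$ and $C_1=600$. In phase $l=1,2,\dots$, until time $T$ is reached: 1. The server and all agents compute, by a common deterministic rule, a probability distribution $\pi_l$ on $A_l$ whose support has at most $\xi=48\,d\log\log d$ elements, such that $V(\pi_l)=\sum_x\pi_l(x)xx^\top$ is invertible and $\max_{x\in A_l}x^\top V(\pi_l)^{-1}x\le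 2d$. (If $A_l$ does not span $\mathbb R^d$, then $V(\pi_l)$, and $V_l$ below, are regarded as operators on $\operatorname{span}(A_l)$.) 2. Put $m_l(x)=\lceil C_14^ld^2\pi_l(x)\ln(MT)\rceil$ and $p_l=\lceil\sum_x m_l(x)/M\rceil$. The server assigns $m_l(x)$ pulls of each arm $x\in\operatorname{Supp}(\pi_l)$ to the agents: the arms are taken by decreasing $m_l(x)$, and agents $1,2,\dots$ are filled one after the other with $p_l$ pulls each. It sends each agent the pairs (index of the arm in the support, number of pulls) that the agent has to carry out. 3. During $p_l$ time steps each agent carries out its pulls; an agent that has finished pulls arbitrary arms of $A_l$ until the phase ends. Then each agent sends the server the average reward of each arm assigned to it, and the server computes the average $\mu(x)$ over all $m_l(x)$ pulls of $x$, for each $x\in\operatorname{Supp}(\pi_l)$. 4. The server computes $V_l=\sum_x m_l(x)xx^\top$, $X=\sum_x m_l(x)\mu(x)x$ and $\hat\theta=V_l^{-1}X$, and sends $\hat\theta$ to all agents. All set $A_{l+1}=\{x\in A_l:\max_{b\in A_l}\langle\hat\theta,b-x\rangle\le 2^{-l+1}\}$. **Theorem.** There is a universal constant $C>0$ such that for all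 $d,M,T,\mathcal D$ as above the choices required in the protocol are possible and, however they are made, for all $\theta^*$ and all noise as above, $$\mathbb E[REG(T)]\le C\,d\sqrt{TM\log T},$$ and the communication cost is always at most $$C\,(Md+d\log\log d)\log T.$$ -/

import Mathlib

open MeasureTheory ProbabilityTheory

namespace DELB

noncomputable section

/-- `ℝ^d` with the Euclidean inner product; actions and parameters live here. -/
abbrev Vec (d : ℕ) : Type := EuclideanSpace ℝ (Fin d)

section Design

variable {d : ℕ}

/-- The span of the active actions. A phase takes place inside this space, so that nothing changes
when the active actions span `ℝ^d`, and the dimension is reduced when they do not. -/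
def actionSpan (A : Finset (Vec d)) : Submodule ℝ (Vec d) :=
  Submodule.span ℝ (A : Set (Vec d))

/-- An active action as an element of the span. -/
def inSpan (A : Finset (Vec d)) (x : {x // x ∈ A}) : actionSpan A :=
  ⟨x.1, Submodule.subset_span (Finset.mem_coe.2 x.2)⟩

/-- The operator `V(w) = ∑_{x ∈ A} w(x) x xᵀ` on the span of `A`. -/
def gram (A : Finset (Vec d)) (w : Vec d → ℝ) : Module.End ℝ (actionSpan A) :=
  ∑ x : {x // x ∈ A},
    w x.1 • (InnerProductSpace.rankOne ℝ (inSpan A x) (inSpan A x)).toLinearMap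

/-- `π` is an admissible design on `A`: a probability distribution on `A` whose support has at most
`ξ = 48 d log log d` elements, whose `V(π)` is invertible (on the span of `A`), and for which
`g(π) = max_{x ∈ A} xᵀ V(π)⁻¹ x ≤ 2 d`. -/
structure IsDesign (A : Finset (Vec d)) (π : Vec d → ℝ) : Prop where
  nonneg : ∀ x, 0 ≤ π x
  eq_zero : ∀ x, x ∉ A → π x = 0
  sum_eq_one : ∑ x ∈ A, π x = 1
  support_card : ((Function.support π).ncard : ℝ) ≤ 48 * d * Real.log (Real.log d)
  isUnit : IsUnit (gram A π)
  le_two_mul : ∀ x : {x // x ∈ A},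
    inner ℝ (inSpan A x) (Ring.inverse (gram A π) (inSpan A x)) ≤ 2 * (d : ℝ)

end Design

/-- The choices that the protocol leaves open. They are deterministic functions of the phase `l` and
of the active set `A`, and they are known to the server and to all agents:
the design; an enumeration of its support (arms are addressed by their index in it); and the arm
that agent `i` pulls at step `s` of the phase when it has already carried out all its assigned pulls
and waits for the others. -/
structure Rules (d M : ℕ) where
  design : ℕ → Finset (Vec d) → Vec d → ℝ
  arms : ℕ → Finset (Vec d) → List (Vec d)
  idle : ℕ → Finset (Vec d) → Fin M → ℕ → Vec d

variable {d M : ℕ}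

/-- `m_l(x) = ⌈600 · 4^l · d² · π_l(x) · ln(MT)⌉`, the number of pulls of `x` in phase `l`. -/
def Rules.pullCount (R : Rules d M) (T l : ℕ) (A : Finset (Vec d)) (x : Vec d) : ℕ :=
  ⌈600 * (4 : ℝ) ^ l * (d : ℝ) ^ 2 * R.design l A x * Real.log ((M : ℝ) * (T : ℝ))⌉₊

/-- The choices are admissible for the action set `D`: in each phase `l ≥ 1` and on each nonempty
active set, the design is admissible, its support is listed without repetition by decreasing number
of pulls (ties in any order), and waiting agents pull active arms. -/
structure Rules.Valid (R : Rules d M) (T : ℕ) (D : Finset (Vec d)) : Prop where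
  isDesign : ∀ l A, 1 ≤ l → A ⊆ D → A.Nonempty → IsDesign A (R.design l A)
  nodup : ∀ l A, 1 ≤ l → A ⊆ D → A.Nonempty → (R.arms l A).Nodup
  mem_arms : ∀ l A, 1 ≤ l → A ⊆ D → A.Nonempty →
    ∀ x, x ∈ R.arms l A ↔ R.design l A x ≠ 0
  decreasing : ∀ l A, 1 ≤ l → A ⊆ D → A.Nonempty →
    (R.arms l A).Pairwise fun x y => R.pullCount T l A y ≤ R.pullCount T l A x
  idle_mem : ∀ l A, 1 ≤ l → A ⊆ D → A.Nonempty → ∀ i s, R.idle l A i s ∈ A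

/-- Total number of pulls of the first `k` listed arms. -/
def Rules.cumPulls (R : Rules d M) (T l : ℕ) (A : Finset (Vec d)) (k : ℕ) : ℕ :=
  (((R.arms l A).take k).map (R.pullCount T l A)).sum

/-- `p_l = ⌈∑_x m_l(x) / M⌉`: the largest number of pulls assigned to one agent, which is the
number of time steps that phase `l` lasts. -/
def Rules.quota (R : Rules d M) (T l : ℕ) (A : Finset (Vec d)) : ℕ :=
  ⌈(R.cumPulls T l A (R.arms l A).length : ℝ) / (M : ℝ)⌉₊

/-- Number of pulls of the `k`-th listed arm that are assigned to agent `i`. The pulls of the phase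
are put in a row (first all those of arm `0`, then all those of arm `1`, and so on), agent `0` takes
the first `p_l` of them, agent `1` the next `p_l`, and so on; so this is the size of the overlap of
the block of arm `k` with the block of agent `i`. -/
def Rules.share (R : Rules d M) (T l : ℕ) (A : Finset (Vec d)) (i : Fin M) (k : ℕ) : ℕ :=
  min (R.cumPulls T l A (k + 1)) ((i.1 + 1) * R.quota T l A)
    - max (R.cumPulls T l A k) (i.1 * R.quota T l A)

/-- What the server sends to agent `i` at the start of phase `l`: the pairs
(index of an arm, number of pulls of it), for the arms of which agent `i` gets at least one pull. -/
def Rules.assignment (R : Rules d M) (T l : ℕ) (A : Finset (Vec d)) (i : Fin M) : List (ℕ × ℕ) :=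
  ((List.range (R.arms l A).length).map fun k => (k, R.share T l A i k)).filter fun q => q.2 ≠ 0

/-- Agent side: the arm pulled at step `s` of phase `l` by agent `i`, which knows `l` and `A` and
has received `msg`. It carries out the assigned pulls in order and then waits. -/
def Rules.play (R : Rules d M) (l : ℕ) (A : Finset (Vec d)) (i : Fin M)
    (msg : List (ℕ × ℕ)) (s : ℕ) : Vec d :=
  (msg.flatMap fun q => List.replicate q.2 ((R.arms l A).getD q.1 0)).getD s (R.idle l A i s)

/-- Agent side: the average rewards that are sent to the server at the end of the phase, one for
each entry of the assignment; `r s` is the reward observed at step `s` of the phase. -/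
def report : List (ℕ × ℕ) → (ℕ → ℝ) → List ℝ
  | [], _ => []
  | q :: rest, r => (∑ s ∈ Finset.range q.2, r s) / (q.2 : ℝ) :: report rest fun s => r (s + q.2)

open Classical in
/-- Server side: the average reward `μ(x)` over all `m_l(x)` pulls of `x` in the phase, from the
averages reported by the agents. -/
def Rules.average (R : Rules d M) (T l : ℕ) (A : Finset (Vec d)) (rep : Fin M → List ℝ)
    (x : Vec d) : ℝ :=
  (∑ i, (((R.assignment T l A i).zip (rep i)).map fun q =>
    if (R.arms l A).getD q.1.1 0 = x then (q.1.2 : ℝ) * q.2 else 0).sum)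
      / (R.pullCount T l A x : ℝ)

/-- Server side: `θ̂ = V_l⁻¹ X` with `V_l = ∑_x m_l(x) x xᵀ` and `X = ∑_x m_l(x) μ(x) x`. -/
def Rules.estimate (R : Rules d M) (T l : ℕ) (A : Finset (Vec d)) (rep : Fin M → List ℝ) : Vec d :=
  (Ring.inverse (gram A fun x => (R.pullCount T l A x : ℝ))
    (∑ x : {x // x ∈ A},
      ((R.pullCount T l A x.1 : ℝ) * R.average T l A rep x.1) • inSpan A x) : actionSpan A)

open Classical in
/-- Server and agents: `A_{l+1} = {x ∈ A_l : max_{b ∈ A_l} ⟨θ̂, b - x⟩ ≤ 2^{-l+1}}`. -/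
def eliminate (l : ℕ) (A : Finset (Vec d)) (θhat : Vec d) : Finset (Vec d) :=
  A.filter fun x => ∀ b ∈ A, inner ℝ θhat (b - x) ≤ (2 : ℝ) ^ (-(l : ℤ) + 1)

/-- The averages reported by agent `i` in a phase `l` that starts at time `τ`, when the reward of
agent `i` at time `t` for the action `x` is `⟨x, θ⟩ + e t i`. -/
def Rules.phaseReport (R : Rules d M) (T : ℕ) (θ : Vec d) (e : ℕ → Fin M → ℝ)
    (l : ℕ) (A : Finset (Vec d)) (τ : ℕ) (i : Fin M) : List ℝ :=
  report (R.assignment T l A i) fun s =>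
    inner ℝ (R.play l A i (R.assignment T l A i) s) θ + e (τ + s) i

/-- The estimate `θ̂` computed at the end of that phase. -/
def Rules.phaseEstimate (R : Rules d M) (T : ℕ) (θ : Vec d) (e : ℕ → Fin M → ℝ)
    (l : ℕ) (A : Finset (Vec d)) (τ : ℕ) : Vec d :=
  R.estimate T l A (R.phaseReport T θ e l A τ)

/-- The run of the protocol: `R.phase T D θ e n` is the pair of the active set `A_l` and the starting
time of phase `l = n + 1`. Time steps are numbered from `0`. -/
def Rules.phase (R : Rules d M) (T : ℕ) (D : Finset (Vec d)) (θ : Vec d) (e : ℕ → Fin M → ℝ) :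
    ℕ → Finset (Vec d) × ℕ
  | 0 => (D, 0)
  | n + 1 =>
    let A := (R.phase T D θ e n).1
    let τ := (R.phase T D θ e n).2
    (eliminate (n + 1) A (R.phaseEstimate T θ e (n + 1) A τ), τ + R.quota T (n + 1) A)

/-- The number `n` of phases that are complete before time step `t`, so that `t` belongs to
phase `n + 1`. -/
def Rules.phaseAt (R : Rules d M) (T : ℕ) (D : Finset (Vec d)) (θ : Vec d) (e : ℕ → Fin M → ℝ)
    (t : ℕ) : ℕ :=
  Nat.findGreatest (fun n => (R.phase T D θ e n).2 ≤ t) t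

/-- `x_{t,i}`, the action of agent `i` at time `t`. -/
def Rules.action (R : Rules d M) (T : ℕ) (D : Finset (Vec d)) (θ : Vec d) (e : ℕ → Fin M → ℝ)
    (t : ℕ) (i : Fin M) : Vec d :=
  let n := R.phaseAt T D θ e t
  let A := (R.phase T D θ e n).1
  let τ := (R.phase T D θ e n).2
  R.play (n + 1) A i (R.assignment T (n + 1) A i) (t - τ)

/-- `REG(T) = ∑_t ∑_i (max_{x ∈ D} ⟨x, θ⟩ - ⟨x_{t,i}, θ⟩)`. -/
def Rules.regret (R : Rules d M) (T : ℕ) (D : Finset (Vec d)) (hD : D.Nonempty) (θ : Vec d)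
    (e : ℕ → Fin M → ℝ) : ℝ :=
  ∑ t ∈ Finset.range T, ∑ i : Fin M,
    (D.sup' hD (fun x => inner ℝ x θ) - inner ℝ (R.action T D θ e t i) θ)

/-- A data packet contains one integer or one real number. -/
abbrev Packet : Type := ℕ ⊕ ℝ

/-- The packets that carry an assignment: two integers for each of its entries. -/
def assignmentPackets (msg : List (ℕ × ℕ)) : List Packet :=
  msg.flatMap fun q => [Sum.inl q.1, Sum.inl q.2]

/-- The packets that carry the average rewards reported by an agent. -/
def reportPackets (rep : List ℝ) : List Packet := rep.map Sum.inr

/-- The packets that carry a vector of `ℝ^d`: its `d` coordinates. -/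
def vectorPackets (v : Vec d) : List Packet := List.ofFn fun j => Sum.inr (v j)

/-- Communication cost: the number of packets exchanged between the server and the agents over the
horizon `T`. Assignments are sent in each phase that starts before the horizon ends; reports and
the estimate are sent in each phase that is complete within the horizon. (A phase lasts at least one
time step, so only the first `T` phases matter.) -/
def Rules.commCost (R : Rules d M) (T : ℕ) (D : Finset (Vec d)) (θ : Vec d)
    (e : ℕ → Fin M → ℝ) : ℕ :=
  ∑ n ∈ Finset.range T,
    let A := (R.phase T D θ e n).1
    let τ := (R.phase T D θ e n).2
    ((if τ < T then
        ∑ i : Fin M, (assignmentPackets (R.assignment T (n + 1) A i)).length else 0)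
      + (if τ + R.quota T (n + 1) A ≤ T then
        ∑ i : Fin M, ((reportPackets (R.phaseReport T θ e (n + 1) A τ i)).length
          + (vectorPackets (R.phaseEstimate T θ e (n + 1) A τ)).length) else 0))

end

end DELB

/-! Design. Among the multisets of `2 * d` active actions, one whose Gram determinant is largest is
nearly optimal: exchanging one of its points for another action cannot increase the determinant, and
the leverage scores add up to the dimension (`exists_exact_design`). The uniform distribution on it
is admissible, because `2 * d` is below `48 d log log d` already for `d = 3`.

Accuracy. The least squares error along an active `x` is linear in the noise of the phase. A union
bound over the arbitrarily large active set is avoided: only the at most `d` coordinates of the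
noise in an eigenbasis of `V_l` are controlled, by Hoeffding at `√(300 log (MT))` standard
deviations, and Cauchy–Schwarz transfers this to all `x` at once (`exists_coordinates`). This costs
a factor `d`, which is why `m_l` contains `d ^ 2`; the resulting error is at most `2^{-l}`
(`exists_estimate_error`).

Regret. With accurate estimates the best action survives and active actions have gap `O(2^{-l})`
(`gap_le`). Phase `l` ends by time `O(4^l d² log(MT) / M)` up to rounding, so the gap at time `t` is
`O(d √(log(MT) / (M t)))` plus a summable term, and summation over times and agents gives the bound
(`regret_le`).

Probability. The pulls of a phase are fixed by its state (active set and starting time), and the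
state is determined by earlier noise (`phase_congr`). Hence Hoeffding applies for each fixed state,
and the failure probabilities are averaged over the disjoint state events rather than summed
(`measureReal_not_accurate_le`).

Communication. Nonempty overlaps of arm blocks with agent blocks form a staircase, so all
assignments of a phase have at most `ξ + M` entries (`sum_length_assignment_le`). Phase lengths grow
like `4^l` and `M < T`, so there are `O(log T)` phases, whatever the noise. -/

namespace DELB

/-! ### Weighted Gram operators and determinant-maximal exact designs. -/

section WeightedGram

variable {E : Type*} [NormedAddCommGroup E] [InnerProductSpace ℝ E]
variable {κ : Type*} [Fintype κ]

/-- The operator `∑ j, w j v_j v_jᵀ`. -/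
noncomputable def weightedGram (w : κ → ℝ) (v : κ → E) : Module.End ℝ E :=
  ∑ j, w j • (InnerProductSpace.rankOne ℝ (v j) (v j)).toLinearMap

lemma weightedGram_apply (w : κ → ℝ) (v : κ → E) (z : E) :
    weightedGram w v z = ∑ j, (w j * inner ℝ (v j) z) • v j := by
  simp [weightedGram, LinearMap.sum_apply, smul_smul]

lemma inner_weightedGram (w : κ → ℝ) (v : κ → E) (u z : E) :
    inner ℝ (weightedGram w v u) z = ∑ j, w j * inner ℝ (v j) u * inner ℝ (v j) z := by
  simp [weightedGram_apply, sum_inner, inner_smul_left]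

lemma inner_weightedGram_comm (w : κ → ℝ) (v : κ → E) (u z : E) :
    inner ℝ (weightedGram w v u) z = inner ℝ u (weightedGram w v z) := by
  rw [← real_inner_comm u, inner_weightedGram, inner_weightedGram]
  exact Finset.sum_congr rfl fun j _ => by ring

lemma inner_weightedGram_self_nonneg {w : κ → ℝ} (hw : ∀ j, 0 ≤ w j) (v : κ → E) (z : E) :
    0 ≤ inner ℝ (weightedGram w v z) z := by
  rw [inner_weightedGram]
  exact Finset.sum_nonneg fun j _ => by
    rw [mul_assoc]; exact mul_nonneg (hw j) (mul_self_nonneg _)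

/-- Cauchy–Schwarz for the form of a weighted Gram operator. -/
lemma inner_weightedGram_sq_le {w : κ → ℝ} (hw : ∀ j, 0 ≤ w j) (v : κ → E) (u z : E) :
    inner ℝ (weightedGram w v u) z ^ 2 ≤
      inner ℝ (weightedGram w v u) u * inner ℝ (weightedGram w v z) z := by
  simp only [inner_weightedGram]
  refine le_trans (le_of_eq ?_) ((Finset.sum_mul_sq_le_sq_mul_sq Finset.univ
    (fun j => √(w j) * inner ℝ (v j) u) (fun j => √(w j) * inner ℝ (v j) z)).trans (le_of_eq ?_))
  · congr 1
    refine Finset.sum_congr rfl fun j _ => ?_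
    linear_combination (-inner ℝ (v j) u * inner ℝ (v j) z) * Real.mul_self_sqrt (hw j)
  · congr 1 <;> refine Finset.sum_congr rfl fun j _ => ?_
    · linear_combination (inner ℝ (v j) u ^ 2) * Real.mul_self_sqrt (hw j)
    · linear_combination (inner ℝ (v j) z ^ 2) * Real.mul_self_sqrt (hw j)

lemma inner_eq_zero_of_weightedGram {w : κ → ℝ} (hw : ∀ j, 0 ≤ w j) {v : κ → E} {z : E}
    (hz : inner ℝ (weightedGram w v z) z = 0) {j : κ} (hj : w j ≠ 0) : inner ℝ (v j) z = 0 := by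
  rw [inner_weightedGram, Finset.sum_eq_zero_iff_of_nonneg fun j _ => by
    rw [mul_assoc]; exact mul_nonneg (hw j) (mul_self_nonneg _)] at hz
  simpa [hj] using hz j (Finset.mem_univ j)

variable [FiniteDimensional ℝ E]

/-- The operator is positive semidefinite, so its kernel consists of the vectors orthogonal to every
`v j` of nonzero weight. -/
lemma isUnit_weightedGram_iff {w : κ → ℝ} (hw : ∀ j, 0 ≤ w j) (v : κ → E) :
    IsUnit (weightedGram w v) ↔ ∀ z, (∀ j, w j ≠ 0 → inner ℝ (v j) z = 0) → z = 0 := by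
  rw [LinearMap.isUnit_iff_ker_eq_bot, LinearMap.ker_eq_bot']
  refine forall_congr' fun z => imp_congr_left ⟨fun h j hj => ?_, fun h => ?_⟩
  · exact inner_eq_zero_of_weightedGram hw (by rw [h, inner_zero_left]) hj
  · rw [weightedGram_apply]
    refine Finset.sum_eq_zero fun j _ => ?_
    by_cases hj : w j = 0
    · simp [hj]
    · simp [h j hj]

/-- Matrix determinant lemma: factoring out `B` leaves a transvection, whose determinant is
explicit. -/
lemma det_sub_rankOne {B N : Module.End ℝ E} (hN : B * N = 1) (y : E) :
    LinearMap.det (B - (InnerProductSpace.rankOne ℝ y y).toLinearMap) =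
      LinearMap.det B * (1 - inner ℝ y (N y)) := by
  have h : B - (InnerProductSpace.rankOne ℝ y y).toLinearMap =
      B * LinearMap.transvection (innerₗ E y) (-(N y)) := by
    ext z
    have hy : B (N y) = y := by rw [← Module.End.mul_apply, hN, Module.End.one_apply]
    simp [LinearMap.transvection.apply, hy, sub_eq_add_neg]
  rw [h, map_mul, LinearMap.transvection.det]
  simp [sub_eq_add_neg]

/-- The leverage scores of a weighted Gram operator add up to the dimension. -/
lemma sum_inner_inverse_weightedGram {w : κ → ℝ} {v : κ → E} {N : Module.End ℝ E}
    (hN : N * weightedGram w v = 1) :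
    ∑ j, w j * inner ℝ (v j) (N (v j)) = Module.finrank ℝ E := by
  rw [← LinearMap.trace_one ℝ E, ← hN, weightedGram, Finset.mul_sum, map_sum]
  refine Finset.sum_congr rfl fun j _ => ?_
  have : N * (w j • (InnerProductSpace.rankOne ℝ (v j) (v j)).toLinearMap) =
      w j • (InnerProductSpace.rankOne ℝ (N (v j)) (v j)).toLinearMap := by
    ext z; simp
  rw [this, map_smul, InnerProductSpace.trace_rankOne, smul_eq_mul]

/-- Among the exact designs of size `n`, one with the largest determinant is nearly optimal for the
`G`-criterion: exchanging one of its points for `x` does not increase the determinant. -/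
theorem exists_exact_design {ι : Type*} [Finite ι] [Nonempty ι] {v : ι → E}
    (hv : Submodule.span ℝ (Set.range v) = ⊤) {n : ℕ} (hn : Module.finrank ℝ E ≤ n) :
    ∃ f : Fin n → ι, IsUnit (weightedGram (fun _ => (1 : ℝ)) (v ∘ f)) ∧
      ∀ i, ((n : ℝ) + 1 - Module.finrank ℝ E) *
        inner ℝ (v i) (Ring.inverse (weightedGram (fun _ => (1 : ℝ)) (v ∘ f)) (v i))
          ≤ Module.finrank ℝ E := by
  classical
  have := Fintype.ofFinite ι
  set S : (Fin n → ι) → Module.End ℝ E := fun f => weightedGram (fun _ => (1 : ℝ)) (v ∘ f) with hS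
  have h01 : ∀ j : Fin n, (0 : ℝ) ≤ (fun _ => (1 : ℝ)) j := fun _ => zero_le_one
  -- A basis chosen among the `v i`, padded arbitrarily to length `n`, has an invertible Gram
  -- operator; so the maximal determinant is nonzero.
  obtain ⟨f₀, hf₀⟩ : ∃ f, IsUnit (S f) := by
    obtain ⟨b, hb, hspan, -⟩ := Submodule.exists_fun_fin_finrank_span_eq ℝ (Set.range v)
    have hk : Module.finrank ℝ (Submodule.span ℝ (Set.range v)) ≤ n := by
      rw [hv, finrank_top]; exact hn
    choose g hg using hb
    refine ⟨fun j => if h : j.1 < _ then g ⟨j.1, h⟩ else Classical.arbitrary ι,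
      (isUnit_weightedGram_iff h01 _).2 fun z hz => ?_⟩
    have hz' : z ∈ (Submodule.span ℝ (Set.range b))ᗮ := by
      rw [Submodule.mem_orthogonal]
      intro u hu
      induction hu using Submodule.span_induction with
      | mem u hu =>
        obtain ⟨j, rfl⟩ := hu
        have := hz ⟨j.1, j.2.trans_le hk⟩ one_ne_zero
        simpa [hg] using this
      | zero => simp
      | add u u' _ _ h h' => rw [inner_add_left, h, h', add_zero]
      | smul a u _ h => rw [inner_smul_left, h, mul_zero]
    rw [hspan, hv, Submodule.top_orthogonal_eq_bot] at hz'
    simpa using hz'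
  obtain ⟨f, -, hf⟩ := Finset.exists_max_image Finset.univ
    (fun f => |LinearMap.det (S f)|) ⟨f₀, Finset.mem_univ _⟩
  have hdet : 0 < |LinearMap.det (S f)| := by
    refine lt_of_lt_of_le ?_ (hf f₀ (Finset.mem_univ _))
    rw [abs_pos]
    exact ((LinearMap.isUnit_iff_isUnit_det _).1 hf₀).ne_zero
  have hunit : IsUnit (S f) := by
    rw [LinearMap.isUnit_iff_isUnit_det]
    exact (abs_pos.1 hdet).isUnit
  refine ⟨f, hunit, fun i => ?_⟩
  set x := v i
  -- With `x` added as an extra point, both the maximiser and its exchanges arise from `B` by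
  -- deleting one rank-one term, so their determinants compare through leverage scores with respect
  -- to `B`.
  set B : Module.End ℝ E := S f + (InnerProductSpace.rankOne ℝ x x).toLinearMap with hB
  have hBw : B = weightedGram (fun _ : Option (Fin n) => (1 : ℝ)) (fun o => o.elim x (v ∘ f)) := by
    simp [hB, hS, weightedGram, Fintype.sum_option, add_comm]
  have hBu : IsUnit B := by
    rw [hBw, isUnit_weightedGram_iff fun _ => zero_le_one]
    intro z hz
    exact (isUnit_weightedGram_iff h01 _).1 hunit z fun j hj => hz (some j) hj
  set N := Ring.inverse B
  have hBN : B * N = 1 := Ring.mul_inverse_cancel _ hBu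
  have hNB : N * B = 1 := Ring.inverse_mul_cancel _ hBu
  set p := inner ℝ x (N x) with hp
  have hBNx : B (N x) = x := by rw [← Module.End.mul_apply, hBN, Module.End.one_apply]
  have hSN : S f (N x) = (1 - p) • x := by
    have : S f (N x) = B (N x) - p • x := by simp [hB, hp]
    rw [this, hBNx, sub_smul, one_smul]
  have hdS : LinearMap.det (S f) = LinearMap.det B * (1 - p) := by
    rw [hp, ← det_sub_rankOne hBN, hB, add_sub_cancel_right]
  have hp1 : p ≤ 1 := by
    have h1 : 0 ≤ inner ℝ (S f (N x)) (N x) := inner_weightedGram_self_nonneg h01 _ _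
    rw [hSN, inner_smul_left, ← hp] at h1
    simp only [conj_trivial] at h1
    nlinarith
  have hp1' : p < 1 := by
    refine lt_of_le_of_ne hp1 fun h => ?_
    rw [hdS, h] at hdet
    simp at hdet
  have hBdet : 0 < |LinearMap.det B| :=
    abs_pos.2 ((LinearMap.isUnit_iff_isUnit_det _).1 hBu).ne_zero
  -- Maximality: deleting `v (f j)` instead of `x` does not give a larger determinant, so `x` has
  -- the smallest leverage.
  have hr : ∀ j, p ≤ inner ℝ (v (f j)) (N (v (f j))) := by
    intro j
    have hupd : S (Function.update f j i) =
        B - (InnerProductSpace.rankOne ℝ (v (f j)) (v (f j))).toLinearMap := by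
      have h1 : S (Function.update f j i) = ∑ a, Function.update
          (fun a => (InnerProductSpace.rankOne ℝ (v (f a)) (v (f a))).toLinearMap) j
          (InnerProductSpace.rankOne ℝ x x).toLinearMap a := by
        simp only [hS, weightedGram, one_smul]
        refine Finset.sum_congr rfl fun a _ => ?_
        rcases eq_or_ne a j with rfl | h
        · simp [x]
        · simp [h]
      have h2 : S f = ∑ a, (InnerProductSpace.rankOne ℝ (v (f a)) (v (f a))).toLinearMap := by
        simp [hS, weightedGram]
      rw [h1, Finset.sum_update_of_mem (Finset.mem_univ j), hB, h2,
        ← Finset.sum_sdiff (Finset.subset_univ {j})]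
      simp only [Finset.sum_singleton]
      abel
    have := hf (Function.update f j i) (Finset.mem_univ _)
    rw [hupd, det_sub_rankOne hBN, hdS, abs_mul, abs_mul, mul_le_mul_iff_right₀ hBdet,
      abs_of_pos (by linarith : 0 < 1 - p)] at this
    linarith [le_abs_self (1 - inner ℝ (v (f j)) (N (v (f j))))]
  -- The `n + 1` leverages with respect to `B` add up to the dimension, and `p` is the smallest, so
  -- `(n + 1) p` is at most the dimension.
  have hsum : p + ∑ j, inner ℝ (v (f j)) (N (v (f j))) = Module.finrank ℝ E := by
    have := sum_inner_inverse_weightedGram (hBw ▸ hNB)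
    simpa [Fintype.sum_option] using this
  have hnp : (n : ℝ) * p ≤ ∑ j, inner ℝ (v (f j)) (N (v (f j))) := by
    simpa using Finset.sum_le_sum fun j (_ : j ∈ Finset.univ) => hr j
  -- Sherman–Morrison: passing from `B` back to `S f` turns the leverage `p` into `p / (1 - p)`.
  have hq : inner ℝ x (Ring.inverse (S f) x) = p / (1 - p) := by
    have : Ring.inverse (S f) x = (1 - p)⁻¹ • N x := by
      have h1 : S f ((1 - p)⁻¹ • N x) = x := by
        rw [map_smul, hSN, smul_smul, inv_mul_cancel₀ (by linarith), one_smul]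
      rw [← h1, ← Module.End.mul_apply, Ring.inverse_mul_cancel _ hunit, Module.End.one_apply, h1]
    rw [this, inner_smul_right, ← hp, div_eq_inv_mul]
  rw [hq, ← mul_div_assoc, div_le_iff₀ (by linarith)]
  nlinarith

end WeightedGram

end DELB

/-! ### Existence of admissible designs and rules. -/

namespace DELB

lemma inverse_apply_of_apply_eq {E : Type*} [AddCommGroup E] [Module ℝ E] {B : Module.End ℝ E}
    (hB : IsUnit B) {x y : E} (h : B y = x) : Ring.inverse B x = y := by
  rw [← h, ← Module.End.mul_apply, Ring.inverse_mul_cancel _ hB, Module.End.one_apply]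

lemma apply_inverse_apply {E : Type*} [AddCommGroup E] [Module ℝ E] {B : Module.End ℝ E}
    (hB : IsUnit B) (x : E) : B (Ring.inverse B x) = x := by
  rw [← Module.End.mul_apply, Ring.mul_inverse_cancel _ hB, Module.End.one_apply]

lemma gram_eq_weightedGram {d : ℕ} (A : Finset (Vec d)) (w : Vec d → ℝ) :
    gram A w = weightedGram (fun x : {x // x ∈ A} => w x.1) (inSpan A) := rfl

lemma span_range_inSpan {d : ℕ} (A : Finset (Vec d)) :
    Submodule.span ℝ (Set.range (inSpan A)) = ⊤ := by
  have h : Set.range (inSpan A) = (Subtype.val : actionSpan A → Vec d) ⁻¹' (A : Set (Vec d)) := by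
    ext y
    constructor
    · rintro ⟨x, rfl⟩
      exact x.2
    · intro hy
      exact ⟨⟨y.1, hy⟩, rfl⟩
  rw [h]
  exact Submodule.span_span_coe_preimage

/-- The constant is the one for which `1 - (log 3)⁻¹ ≥ 1 / 24`. -/
lemma le_log_three : (24 / 23 : ℝ) ≤ Real.log 3 := by
  have h27 : Real.log 27 = 3 * Real.log 3 := by
    rw [show (27 : ℝ) = 3 ^ 3 by norm_num, Real.log_pow]; norm_num
  have h16 : Real.log 27 = 4 * Real.log 2 + Real.log (27 / 16) := by
    rw [show (27 : ℝ) = 2 ^ 4 * (27 / 16) by norm_num, Real.log_mul (by norm_num) (by norm_num),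
      Real.log_pow]
    norm_num
  have h := Real.one_sub_inv_le_log_of_pos (show (0 : ℝ) < 27 / 16 by norm_num)
  have := Real.log_two_gt_d9
  norm_num at h
  linarith

/-- This is exactly `2 * d ≤ 48 d log log d`, which leaves room for a support of `2 * d` points. -/
lemma one_div_le_log_log {d : ℕ} (hd : 3 ≤ d) : 1 / 24 ≤ Real.log (Real.log d) := by
  have h3 := le_log_three
  have hlog : Real.log 3 ≤ Real.log d := Real.log_le_log (by norm_num) (by exact_mod_cast hd)
  have hpos : 0 < Real.log d := by linarith
  have h := Real.one_sub_inv_le_log_of_pos hpos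
  have : (Real.log d)⁻¹ ≤ 23 / 24 := by
    rw [inv_le_comm₀ hpos (by norm_num)]
    norm_num
    linarith
  linarith

theorem exists_isDesign {d : ℕ} (hd : 3 ≤ d) {A : Finset (Vec d)} (hA : A.Nonempty) :
    ∃ π, IsDesign A π := by
  classical
  have hne : Nonempty {x // x ∈ A} := hA.to_subtype
  have hk : Module.finrank ℝ (actionSpan A) ≤ d := by
    simpa using Submodule.finrank_le (actionSpan A)
  obtain ⟨f, hfu, hf⟩ := exists_exact_design (span_range_inSpan A) (hk.trans (by omega : d ≤ 2 * d))
  have hd0 : (0 : ℝ) < d := by exact_mod_cast (by omega : 0 < d)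
  set c : ℝ := (2 * d : ℝ)⁻¹ with hc
  have hc0 : 0 < c := by positivity
  -- Uniform weight on the points of the exact design, counted with multiplicity.
  let π : Vec d → ℝ := fun x => c * ∑ j, if (f j).1 = x then 1 else 0
  have hgram : gram A π = c • weightedGram (fun _ => (1 : ℝ)) (inSpan A ∘ f) := by
    rw [gram_eq_weightedGram]
    simp only [weightedGram, π, Finset.smul_sum, Finset.mul_sum, Finset.sum_smul, smul_smul]
    rw [Finset.sum_comm]
    refine Finset.sum_congr rfl fun j _ => ?_
    rw [Finset.sum_eq_single (f j)]
    · simp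
    · intro x _ hx
      have : (f j).1 ≠ x.1 := fun h => hx (Subtype.ext h.symm)
      simp [this]
    · simp
  have hgu : IsUnit (gram A π) := by
    rw [hgram]
    exact hfu.smul (Units.mk0 c hc0.ne')
  refine ⟨π, ?_, ?_, ?_, ?_, hgu, ?_⟩
  · intro x
    exact mul_nonneg hc0.le (Finset.sum_nonneg fun j _ => by split_ifs <;> norm_num)
  · intro x hx
    have : ∀ j, (f j).1 ≠ x := fun j h => hx (h ▸ (f j).2)
    simp [π, this]
  · simp only [π]
    rw [← Finset.mul_sum, Finset.sum_comm]
    simp only [Finset.sum_ite_eq, Finset.coe_mem, if_true]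
    simp only [Finset.sum_const, Finset.card_univ, Fintype.card_fin, nsmul_eq_mul, hc]
    push_cast
    field_simp
  · have hsub : Function.support π ⊆ Set.range fun j => (f j).1 := by
      intro x hx
      by_contra h
      apply hx
      have : ∀ j, (f j).1 ≠ x := fun j hj => h ⟨j, hj⟩
      simp [π, this]
    have h1 : (Function.support π).ncard ≤ 2 * d := by
      refine (Set.ncard_le_ncard hsub (Set.finite_range _)).trans ?_
      rw [← Set.image_univ]
      refine (Set.ncard_image_le Set.finite_univ).trans ?_
      simp [Set.ncard_univ]
    have h2 : ((Function.support π).ncard : ℝ) ≤ 2 * d := by exact_mod_cast h1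
    have := one_div_le_log_log hd
    nlinarith
  · intro x
    have hinv : Ring.inverse (gram A π) (inSpan A x) = c⁻¹ •
        Ring.inverse (weightedGram (fun _ => (1 : ℝ)) (inSpan A ∘ f)) (inSpan A x) := by
      refine inverse_apply_of_apply_eq hgu ?_
      rw [hgram, LinearMap.smul_apply, map_smul, apply_inverse_apply hfu, smul_smul,
        mul_inv_cancel₀ hc0.ne', one_smul]
    rw [hinv]
    refine (real_inner_smul_right (F := actionSpan A) _ _ _).trans_le ?_
    rw [hc, inv_inv]
    have h := hf x
    have hk' : (Module.finrank ℝ (actionSpan A) : ℝ) ≤ d := by exact_mod_cast hk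
    push_cast at h
    set q := inner ℝ (inSpan A x)
      (Ring.inverse (weightedGram (fun _ => (1 : ℝ)) (inSpan A ∘ f)) (inSpan A x))
    -- For `n = 2d` and dimension `k ≤ d` the factor `n + 1 - k` exceeds `k`. Rescaling by `c⁻¹ =
    -- 2d` then gives the required `2d`.
    have hq : q ≤ 1 := by
      by_contra hq
      nlinarith
    nlinarith

theorem exists_valid_rules {d M T : ℕ} (hd : 3 ≤ d) (D : Finset (Vec d)) :
    ∃ R : Rules d M, R.Valid T D := by
  classical
  choose! design hdesign using fun (A : Finset (Vec d)) (hA : A.Nonempty) => exists_isDesign hd hA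
  choose! idle hidle using fun (A : Finset (Vec d)) (hA : A.Nonempty) => hA
  -- `pullCount` depends only on the design, so rules without a list of arms suffice to define the
  -- sorting key.
  let R₀ : Rules d M := ⟨fun _ => design, fun _ _ => [], fun _ A _ _ => idle A⟩
  let r : ℕ → Finset (Vec d) → Vec d → Vec d → Prop :=
    fun l A x y => R₀.pullCount T l A y ≤ R₀.pullCount T l A x
  have htot : ∀ l A, Std.Total (r l A) := fun l A => ⟨fun x y => le_total _ _⟩
  have htrans : ∀ l A, IsTrans _ (r l A) := fun l A => ⟨fun x y z h h' => le_trans h' h⟩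
  let R : Rules d M := ⟨fun _ => design,
    fun l A => List.insertionSort (r l A) (A.filter fun x => design A x ≠ 0).toList,
    fun _ A _ _ => idle A⟩
  refine ⟨R, ⟨fun l A _ _ hA => hdesign A hA, fun l A _ _ _ => ?_, fun l A _ _ hA x => ?_,
    fun l A _ _ _ => ?_, fun l A _ _ hA _ _ => hidle A hA⟩⟩
  · exact (List.perm_insertionSort _ _).nodup_iff.2 (Finset.nodup_toList _)
  · rw [(List.perm_insertionSort (r l A) _).mem_iff, Finset.mem_toList, Finset.mem_filter]
    exact ⟨fun h => h.2, fun h => ⟨by_contra fun hx => h ((hdesign A hA).eq_zero x hx), h⟩⟩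
  · exact List.pairwise_insertionSort (r l A) _

end DELB

/-! ### Assignments, reports and the bookkeeping of pulls. -/

namespace DELB

section Lists

lemma sum_map_filter_eq {α β : Type*} [AddCommMonoid β] (p : α → Bool) (g : α → β) (L : List α)
    (h : ∀ a ∈ L, p a = false → g a = 0) : ((L.filter p).map g).sum = (L.map g).sum := by
  induction L with
  | nil => rfl
  | cons a L ih =>
    have ih := ih fun b hb => h b (List.mem_cons_of_mem _ hb)
    by_cases ha : p a
    · simp [ha, ih]
    · simp [ha, ih, h a List.mem_cons_self (by simpa using ha)]

/-- The pulls prescribed by a message, in order, when `a k` is the arm with index `k`. -/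
def expand {α : Type*} (a : ℕ → α) (msg : List (ℕ × ℕ)) : List α :=
  msg.flatMap fun q => List.replicate q.2 (a q.1)

lemma length_expand {α : Type*} (a : ℕ → α) (msg : List (ℕ × ℕ)) :
    (expand a msg).length = (msg.map fun q => q.2).sum := by
  simp [expand, List.length_flatMap]

/-- The induction step for every sum over the positions of `expand`: the first block splits off and
the remaining positions shift. -/
lemma sum_range_length_expand_cons {α β : Type*} [AddCommMonoid β] (a : ℕ → α) (q : ℕ × ℕ)
    (msg : List (ℕ × ℕ)) (z : α) (F : α → ℕ → β) :
    ∑ s ∈ Finset.range (expand a (q :: msg)).length, F ((expand a (q :: msg)).getD s z) s =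
      ∑ s ∈ Finset.range q.2, F (a q.1) s +
        ∑ s ∈ Finset.range (expand a msg).length, F ((expand a msg).getD s z) (s + q.2) := by
  have h : expand a (q :: msg) = List.replicate q.2 (a q.1) ++ expand a msg := by simp [expand]
  rw [h, List.length_append, List.length_replicate, Finset.sum_range_add]
  congr 1
  · refine Finset.sum_congr rfl fun s hs => ?_
    rw [Finset.mem_range] at hs
    rw [List.getD_append _ _ _ _ (by simpa using hs)]
    simp [List.getD_eq_getElem?_getD, hs]
  · refine Finset.sum_congr rfl fun s _ => ?_
    rw [List.getD_append_right _ _ _ _ (by simp), List.length_replicate, Nat.add_sub_cancel_left,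
      add_comm s]

/-- Multiplying a reported average by its count restores the sum of the block; an empty block
contributes `0` on both sides despite the division by zero. -/
lemma sum_zip_report {α : Type*} [DecidableEq α] (a : ℕ → α) (z x : α) (msg : List (ℕ × ℕ)) (r : ℕ → ℝ) :
    ((msg.zip (report msg r)).map fun q =>
      if a q.1.1 = x then (q.1.2 : ℝ) * q.2 else 0).sum =
    ∑ s ∈ Finset.range (expand a msg).length,
      if (expand a msg).getD s z = x then r s else 0 := by
  induction msg generalizing r with
  | nil => simp [expand]
  | cons q msg ih =>
    have h := sum_range_length_expand_cons a q msg z (fun y s => if y = x then r s else 0)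
    simp only [report, List.zip_cons_cons, List.map_cons, List.sum_cons]
    rw [ih, h]
    congr 1
    by_cases hq : a q.1 = x
    · simp only [hq, if_true]
      rcases Nat.eq_zero_or_pos q.2 with h0 | h0
      · simp [h0]
      · field_simp
    · simp [hq]

lemma sum_expand_eq {α : Type*} [DecidableEq α] (a : ℕ → α) (z x : α) (msg : List (ℕ × ℕ)) :
    ∑ s ∈ Finset.range (expand a msg).length, (if (expand a msg).getD s z = x then 1 else 0) =
      (msg.map fun q => if a q.1 = x then q.2 else 0).sum := by
  induction msg with
  | nil => simp [expand]
  | cons q msg ih =>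
    have h := sum_range_length_expand_cons a q msg z (fun y _ => if y = x then 1 else 0)
    rw [h, ih]
    by_cases hq : a q.1 = x <;> simp [hq]

lemma length_report (msg : List (ℕ × ℕ)) (r : ℕ → ℝ) : (report msg r).length = msg.length := by
  induction msg generalizing r with
  | nil => rfl
  | cons q msg ih => simp [report, ih]

lemma report_congr (msg : List (ℕ × ℕ)) {r r' : ℕ → ℝ}
    (h : ∀ s < (msg.map fun q => q.2).sum, r s = r' s) : report msg r = report msg r' := by
  induction msg generalizing r r' with
  | nil => rfl
  | cons q msg ih =>
    simp only [List.map_cons, List.sum_cons] at h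
    simp only [report]
    rw [ih fun s hs => h (s + q.2) (by omega), Finset.sum_congr rfl fun s hs => h s ?_]
    rw [Finset.mem_range] at hs
    omega

lemma length_assignmentPackets (msg : List (ℕ × ℕ)) :
    (assignmentPackets msg).length = 2 * msg.length := by
  simp [assignmentPackets, List.length_flatMap, mul_comm]

end Lists

section Shares

variable {d M : ℕ} (R : Rules d M) (T l : ℕ) (A : Finset (Vec d))

lemma Rules.cumPulls_succ {k : ℕ} (hk : k < (R.arms l A).length) :
    R.cumPulls T l A (k + 1) =
      R.cumPulls T l A k + R.pullCount T l A ((R.arms l A).getD k 0) := by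
  rw [Rules.cumPulls, Rules.cumPulls, List.take_succ_eq_append_getElem hk, List.map_append,
    List.sum_append, List.getD_eq_getElem _ _ hk]
  simp

lemma Rules.cumPulls_mono : Monotone (R.cumPulls T l A) := by
  refine monotone_nat_of_le_succ fun k => ?_
  by_cases hk : k < (R.arms l A).length
  · rw [R.cumPulls_succ T l A hk]
    exact Nat.le_add_right _ _
  · rw [Rules.cumPulls, Rules.cumPulls, List.take_of_length_le (by omega),
      List.take_of_length_le (by omega)]

lemma Rules.cumPulls_length_le (hM : 1 ≤ M) :
    R.cumPulls T l A (R.arms l A).length ≤ M * R.quota T l A := by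
  have hM0 : (0 : ℝ) < M := by exact_mod_cast hM
  have := Nat.le_ceil ((R.cumPulls T l A (R.arms l A).length : ℝ) / (M : ℝ))
  rw [div_le_iff₀ hM0] at this
  rw [mul_comm]
  exact_mod_cast this

lemma Rules.sum_share (hM : 1 ≤ M) {k : ℕ} (hk : k < (R.arms l A).length) :
    ∑ i, R.share T l A i k = R.pullCount T l A ((R.arms l A).getD k 0) := by
  have hmono := R.cumPulls_mono T l A
  have h1 := hmono (Nat.le_add_right k 1)
  have h2 := (hmono (Nat.succ_le_of_lt hk)).trans (R.cumPulls_length_le T l A hM)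
  have h3 := R.cumPulls_succ T l A hk
  set a := R.cumPulls T l A k
  set b := R.cumPulls T l A (k + 1)
  set q := R.quota T l A
  -- Clamping `i * q` to the block `[a, b]` of the arm turns the shares into increments. They
  -- telescope from `a` to `b`, since `b ≤ M * q`.
  let f : ℕ → ℕ := fun i => min b (max a (i * q))
  have hf : Monotone f := fun i j hij => by
    have := Nat.mul_le_mul_right q hij
    simp only [f]
    omega
  have hshare : ∀ i : Fin M, R.share T l A i k = f (i.1 + 1) - f i.1 := by
    intro i
    have : i.1 * q ≤ (i.1 + 1) * q := Nat.mul_le_mul_right q (Nat.le_succ _)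
    change min b ((i.1 + 1) * q) - max a (i.1 * q) = _
    simp only [f]
    omega
  rw [Finset.sum_congr rfl fun i _ => hshare i, Fin.sum_univ_eq_sum_range (fun i => f (i + 1) - f i),
    Finset.sum_range_tsub hf]
  simp only [f] at h2 ⊢
  omega

lemma Rules.sum_range_share_le (i : Fin M) (n : ℕ) :
    ∑ k ∈ Finset.range n, R.share T l A i k ≤ R.quota T l A := by
  have hmono := R.cumPulls_mono T l A
  set q := R.quota T l A
  have hq : (i.1 + 1) * q = i.1 * q + q := by ring
  -- The same telescoping with the roles exchanged: arm boundaries are clamped to the block of the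
  -- agent.
  let f : ℕ → ℕ := fun k => min ((i.1 + 1) * q) (max (i.1 * q) (R.cumPulls T l A k))
  have hf : Monotone f := fun k j hkj => by
    have := hmono hkj
    simp only [f]
    omega
  have hshare : ∀ k, R.share T l A i k = f (k + 1) - f k := by
    intro k
    have := hmono (Nat.le_add_right k 1)
    change min (R.cumPulls T l A (k + 1)) ((i.1 + 1) * q) - max (R.cumPulls T l A k) (i.1 * q) = _
    simp only [f]
    omega
  rw [Finset.sum_congr rfl fun k _ => hshare k, Finset.sum_range_tsub hf]
  simp only [f]
  omega

/-- The pulls assigned to agent `i`, in the order in which it carries them out. -/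
noncomputable def Rules.pulls (i : Fin M) : List (Vec d) :=
  expand (fun k => (R.arms l A).getD k 0) (R.assignment T l A i)

lemma Rules.sum_map_assignment {β : Type*} [AddCommMonoid β] (i : Fin M) (g : ℕ × ℕ → β)
    (hg : ∀ k, g (k, 0) = 0) :
    ((R.assignment T l A i).map g).sum =
      ∑ k ∈ Finset.range (R.arms l A).length, g (k, R.share T l A i k) := by
  rw [Rules.assignment, sum_map_filter_eq, List.map_map]
  · rfl
  · intro q _ hq
    have : q = (q.1, 0) := Prod.ext rfl (by simpa using hq)
    rw [this, hg]

lemma Rules.length_pulls_le (i : Fin M) : (R.pulls T l A i).length ≤ R.quota T l A := by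
  rw [Rules.pulls, length_expand, R.sum_map_assignment T l A i _ fun _ => rfl]
  exact R.sum_range_share_le T l A i _

/-- Neighbouring blocks of agents and arms form a staircase. -/
lemma Rules.sum_length_assignment_le :
    ∑ i, (R.assignment T l A i).length ≤ (R.arms l A).length + M := by
  classical
  set N := (R.arms l A).length
  have h1 : ∀ i, (R.assignment T l A i).length =
      ∑ k ∈ Finset.range N, if R.share T l A i k ≠ 0 then 1 else 0 := by
    intro i
    rw [Rules.assignment, ← List.countP_eq_length_filter, List.countP_map,
      List.countP_eq_length_filter, ← Finset.card_filter]
    rw [Finset.card_def, Finset.filter_val]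
    simp only [Finset.range_val, Multiset.range, Multiset.filter_coe, Multiset.coe_card]
    congr 2
  rw [Finset.sum_congr rfl fun i _ => h1 i, ← Finset.sum_product', ← Finset.card_filter,
    ← Finset.card_range (N + M)]
  -- On a staircase the sum of the two indices is injective, and it is less than `N + M`.
  refine Finset.card_le_card_of_injOn (fun p => p.1.1 + p.2) ?_ ?_
  · rintro ⟨i, k⟩ h
    have h := i.2
    simp_all
    omega
  -- Otherwise the block of arm `k` would begin before that of agent `j`, and arm `m`, which ends no
  -- later than `k` begins, could not reach agent `j`.
  · have key : ∀ (i j : Fin M) (k m : ℕ), R.share T l A i k ≠ 0 → R.share T l A j m ≠ 0 →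
        i < j → m < k → False := by
      intro i j k m hi hj hij hmk
      have hq : (i.1 + 1) * R.quota T l A ≤ j.1 * R.quota T l A := Nat.mul_le_mul_right _ hij
      have hc := R.cumPulls_mono T l A hmk
      simp only [Rules.share, Nat.succ_eq_add_one] at hi hj hc
      omega
    rintro ⟨i, k⟩ hi ⟨j, m⟩ hj hij
    simp only [Finset.coe_filter, Finset.mem_product, Set.mem_ofPred_eq] at hi hj hij
    rcases lt_trichotomy i j with h | h | h
    · exact (key i j k m hi.2 hj.2 h (by have : i.1 < j.1 := h; omega)).elim
    · subst h
      simpa using hij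
    · exact (key j i m k hj.2 hi.2 h (by have : j.1 < i.1 := h; omega)).elim

/-- Every listed arm is pulled exactly as often as prescribed. -/
lemma Rules.sum_pulls_eq (hM : 1 ≤ M) (hnodup : (R.arms l A).Nodup) {x : Vec d}
    (hx : x ∉ R.arms l A → R.pullCount T l A x = 0) :
    ∑ i, ∑ s ∈ Finset.range (R.pulls T l A i).length,
      (if (R.pulls T l A i).getD s 0 = x then 1 else 0) = R.pullCount T l A x := by
  have h1 : ∀ i, ∑ s ∈ Finset.range (R.pulls T l A i).length,
      (if (R.pulls T l A i).getD s 0 = x then 1 else 0) =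
      ∑ k ∈ Finset.range (R.arms l A).length,
        if (R.arms l A).getD k 0 = x then R.share T l A i k else 0 := by
    intro i
    rw [Rules.pulls, sum_expand_eq, R.sum_map_assignment T l A i _ fun k => by simp]
  rw [Finset.sum_congr rfl fun i _ => h1 i, Finset.sum_comm]
  have h2 : ∀ k ∈ Finset.range (R.arms l A).length,
      ∑ i, (if (R.arms l A).getD k 0 = x then R.share T l A i k else 0) =
        if (R.arms l A).getD k 0 = x then R.pullCount T l A x else 0 := by
    intro k hk
    split_ifs with h
    · rw [R.sum_share T l A hM (Finset.mem_range.1 hk), h]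
    · simp
  rw [Finset.sum_congr rfl h2]
  by_cases hxm : x ∈ R.arms l A
  · obtain ⟨k, hk, rfl⟩ := List.mem_iff_getElem.1 hxm
    rw [Finset.sum_eq_single k]
    · simp [hk]
    · intro j hj hjk
      rw [Finset.mem_range] at hj
      rw [if_neg]
      rw [List.getD_eq_getElem _ _ hj]
      exact fun h => hjk ((hnodup.getElem_inj_iff).1 h)
    · intro h
      exact (h (Finset.mem_range.2 hk)).elim
  · rw [hx hxm]
    simp

/-- During the assigned steps neither default value, `idle` or `0`, is ever used. -/
lemma Rules.play_of_lt (i : Fin M) {s : ℕ} (hs : s < (R.pulls T l A i).length) :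
    R.play l A i (R.assignment T l A i) s = (R.pulls T l A i).getD s 0 := by
  rw [List.getD_eq_getElem _ _ hs]
  exact List.getD_eq_getElem _ _ hs

/-- The server recovers the sum of the rewards of each arm. -/
lemma Rules.pullCount_mul_average (θ : Vec d) (e : ℕ → Fin M → ℝ) (τ : ℕ) {x : Vec d}
    (hx : R.pullCount T l A x ≠ 0) :
    (R.pullCount T l A x : ℝ) * R.average T l A (R.phaseReport T θ e l A τ) x =
      ∑ i, ∑ s ∈ Finset.range (R.pulls T l A i).length,
        if (R.pulls T l A i).getD s 0 = x then
          inner ℝ ((R.pulls T l A i).getD s 0) θ + e (τ + s) i else 0 := by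
  have hx' : (R.pullCount T l A x : ℝ) ≠ 0 := by exact_mod_cast hx
  rw [Rules.average, mul_div_cancel₀ _ hx']
  refine Finset.sum_congr rfl fun i _ => ?_
  have := sum_zip_report (fun k => (R.arms l A).getD k 0) 0 x (R.assignment T l A i)
    (fun s => inner ℝ (R.play l A i (R.assignment T l A i) s) θ + e (τ + s) i)
  refine this.trans (Finset.sum_congr rfl fun s hs => ?_)
  simp only [R.play_of_lt T l A i (Finset.mem_range.1 hs)]
  rfl

lemma Rules.mem_arms_of_mem_pulls {i : Fin M} {x : Vec d} (hx : x ∈ R.pulls T l A i) :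
    x ∈ R.arms l A := by
  simp only [Rules.pulls, expand, List.mem_flatMap] at hx
  obtain ⟨q, hq, hxq⟩ := hx
  obtain ⟨-, rfl⟩ := List.mem_replicate.1 hxq
  simp only [Rules.assignment, List.mem_filter, List.mem_map, List.mem_range] at hq
  obtain ⟨⟨k, hk, rfl⟩, -⟩ := hq
  rw [List.getD_eq_getElem _ _ hk]
  exact List.getElem_mem _

end Shares

end DELB

/-! ### Accuracy of the least squares estimate of one phase. -/

namespace DELB

section WeightedGram

variable {E : Type*} [NormedAddCommGroup E] [InnerProductSpace ℝ E]
variable {κ : Type*} [Fintype κ]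

lemma inner_inverse_nonneg {w : κ → ℝ} (hw : ∀ j, 0 ≤ w j) {v : κ → E}
    (hu : IsUnit (weightedGram w v)) (x : E) :
    0 ≤ inner ℝ x (Ring.inverse (weightedGram w v) x) := by
  have h := inner_weightedGram_self_nonneg hw v (Ring.inverse (weightedGram w v) x)
  rwa [apply_inverse_apply hu] at h

variable [FiniteDimensional ℝ E]

lemma isUnit_weightedGram_of_le {π w : κ → ℝ} {v : κ → E} {c : ℝ} (hc : 0 < c)
    (hπ : ∀ j, 0 ≤ π j) (hw : ∀ j, c * π j ≤ w j) (hu : IsUnit (weightedGram π v)) :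
    IsUnit (weightedGram w v) := by
  rw [isUnit_weightedGram_iff fun j => (mul_nonneg hc.le (hπ j)).trans (hw j)]
  intro z hz
  refine (isUnit_weightedGram_iff hπ v).1 hu z fun j hj => hz j ?_
  have : 0 < c * π j := mul_pos hc (lt_of_le_of_ne (hπ j) (Ne.symm hj))
  exact (this.trans_le (hw j)).ne'

/-- Larger weights give smaller leverage scores. -/
lemma mul_inner_inverse_le {π w : κ → ℝ} {v : κ → E} {c : ℝ} (hc : 0 < c)
    (hπ : ∀ j, 0 ≤ π j) (hw : ∀ j, c * π j ≤ w j) (hu : IsUnit (weightedGram π v)) (x : E) :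
    c * inner ℝ x (Ring.inverse (weightedGram w v) x) ≤
      inner ℝ x (Ring.inverse (weightedGram π v) x) := by
  have hw0 : ∀ j, 0 ≤ w j := fun j => (mul_nonneg hc.le (hπ j)).trans (hw j)
  have hu' := isUnit_weightedGram_of_le hc hπ hw hu
  have ha := inner_inverse_nonneg hw0 hu' x
  have hb := inner_inverse_nonneg hπ hu x
  -- With `a`, `b` the leverages for `w` and `π`, Cauchy–Schwarz gives `a ^ 2 ≤ b * g`, where `g` is
  -- the `π`-form at the `w`-solution, and `c * g ≤ a`.
  have hcs := inner_weightedGram_sq_le hπ v (Ring.inverse (weightedGram π v) x)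
    (Ring.inverse (weightedGram w v) x)
  have hle : c * inner ℝ (weightedGram π v (Ring.inverse (weightedGram w v) x))
      (Ring.inverse (weightedGram w v) x) ≤ inner ℝ x (Ring.inverse (weightedGram w v) x) := by
    have h : inner ℝ x (Ring.inverse (weightedGram w v) x) =
        inner ℝ (weightedGram w v (Ring.inverse (weightedGram w v) x))
          (Ring.inverse (weightedGram w v) x) := by rw [apply_inverse_apply hu']
    rw [h, inner_weightedGram, inner_weightedGram, Finset.mul_sum]
    refine Finset.sum_le_sum fun j _ => ?_
    nlinarith [mul_self_nonneg (inner ℝ (v j) (Ring.inverse (weightedGram w v) x)), hw j]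
  rw [apply_inverse_apply hu] at hcs
  set a := inner ℝ x (Ring.inverse (weightedGram w v) x)
  set b := inner ℝ x (Ring.inverse (weightedGram π v) x)
  rcases ha.eq_or_lt with h0 | h0
  · rw [← h0, mul_zero]; exact hb
  · by_contra! hlt
    nlinarith [mul_le_mul_of_nonneg_left hle hb]

/-- If every coordinate of the noise `∑ j, η j u_j` in an eigenbasis of the Gram operator is at most
`ε` standard deviations, then all linear functionals of the least squares error are controlled. -/
lemma exists_coordinates (u : κ → E) (hu : IsUnit (weightedGram (fun _ => (1 : ℝ)) u)) :
    ∃ a : Fin (Module.finrank ℝ E) → κ → ℝ, ∀ (η : κ → ℝ) (ε : ℝ), 0 ≤ ε →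
      (∀ i, |∑ j, a i j * η j| ≤ ε * √(∑ j, a i j ^ 2)) → ∀ x : E,
        inner ℝ x (Ring.inverse (weightedGram (fun _ => (1 : ℝ)) u) (∑ j, η j • u j)) ^ 2 ≤
          inner ℝ x (Ring.inverse (weightedGram (fun _ => (1 : ℝ)) u) x) *
            (Module.finrank ℝ E * ε ^ 2) := by
  set V := weightedGram (fun _ => (1 : ℝ)) u with hV
  have h01 : ∀ j : κ, (0 : ℝ) ≤ (fun _ => (1 : ℝ)) j := fun _ => zero_le_one
  have hsymm : V.IsSymmetric := fun x y => inner_weightedGram_comm _ _ _ _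
  set b := hsymm.eigenvectorBasis rfl
  -- These coefficients depend on the design points only, not on the noise; their squares add up to
  -- the eigenvalue of `b i`.
  refine ⟨fun i j => inner ℝ (u j) (b i), fun η ε hε h x => ?_⟩
  set S := ∑ j, η j • u j with hS
  have hbS : ∀ i, inner ℝ (b i) S = ∑ j, inner ℝ (u j) (b i) * η j := by
    intro i
    rw [hS, inner_sum]
    refine Finset.sum_congr rfl fun j _ => ?_
    rw [inner_smul_right, real_inner_comm, mul_comm]
  -- The `i`-th coordinate of `S` has square at most `ε ^ 2 * r`, and the inverse operator divides
  -- by the eigenvalue `r`.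
  have hterm : ∀ i, inner ℝ S (b i) * inner ℝ (b i) (Ring.inverse V S) ≤ ε ^ 2 := by
    intro i
    set r := hsymm.eigenvalues rfl i with hr
    have hVb : V (b i) = r • b i := by
      exact hsymm.apply_eigenvectorBasis rfl i
    have hr2 : r = ∑ j, inner ℝ (u j) (b i) ^ 2 := by
      have h1 : inner ℝ (V (b i)) (b i) = r := by
        rw [hVb, inner_smul_left, real_inner_self_eq_norm_sq, b.orthonormal.1 i]
        simp
      rw [← h1, hV, inner_weightedGram]
      exact Finset.sum_congr rfl fun j _ => by ring
    have hrS : r * inner ℝ (b i) (Ring.inverse V S) = inner ℝ (b i) S := by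
      have := hsymm (b i) (Ring.inverse V S)
      rw [apply_inverse_apply hu, hVb, inner_smul_left] at this
      exact this
    have hr0 : 0 ≤ r := hr2 ▸ Finset.sum_nonneg fun j _ => sq_nonneg _
    have hi : inner ℝ (b i) S ^ 2 ≤ ε ^ 2 * r := by
      have := h i
      simp only [← hbS, ← hr2] at this
      calc inner ℝ (b i) S ^ 2 = |inner ℝ (b i) S| ^ 2 := (sq_abs _).symm
        _ ≤ (ε * √r) ^ 2 := pow_le_pow_left₀ (abs_nonneg _) this 2
        _ = ε ^ 2 * r := by rw [mul_pow, Real.sq_sqrt hr0]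
    rw [real_inner_comm]
    rcases hr0.eq_or_lt with h0 | h0
    · rw [← h0, zero_mul] at hrS
      rw [← hrS, zero_mul]
      positivity
    · rw [← hrS] at hi ⊢
      by_contra! hlt
      nlinarith
  have hSS : inner ℝ S (Ring.inverse V S) ≤ Module.finrank ℝ E * ε ^ 2 := by
    rw [← b.sum_inner_mul_inner]
    refine (Finset.sum_le_sum fun i _ => hterm i).trans ?_
    simp
  have hcs := inner_weightedGram_sq_le h01 u (Ring.inverse V x) (Ring.inverse V S)
  rw [← hV, apply_inverse_apply hu, apply_inverse_apply hu] at hcs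
  exact hcs.trans (mul_le_mul_of_nonneg_left hSS (inner_inverse_nonneg h01 hu x))

end WeightedGram

section Phase

variable {d M : ℕ} (R : Rules d M) (T l : ℕ) (A : Finset (Vec d))

/-- The assigned pulls of a phase, indexed by agent and step. -/
abbrev Rules.Slot : Type := Σ i : Fin M, Fin (R.pulls T l A i).length

/-- The arm pulled in a slot. -/
noncomputable def Rules.slotArm (j : R.Slot T l A) : Vec d := (R.pulls T l A j.1)[j.2]

lemma Rules.sum_slot {β : Type*} [AddCommMonoid β] (F : Fin M → ℕ → Vec d → β) :
    ∑ j : R.Slot T l A, F j.1 j.2 (R.slotArm T l A j) =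
      ∑ i, ∑ s ∈ Finset.range (R.pulls T l A i).length, F i s ((R.pulls T l A i).getD s 0) := by
  rw [Fintype.sum_sigma]
  refine Finset.sum_congr rfl fun i _ => ?_
  rw [Finset.sum_range]
  refine Finset.sum_congr rfl fun s _ => ?_
  rw [List.getD_eq_getElem _ _ s.2]
  rfl

/-- Regroups a sum over pulls by the arm pulled; it serves for both the Gram operator and the vector
`X`. -/
lemma sum_subtype_smul {κ V : Type*} [Fintype κ] [AddCommGroup V] [Module ℝ V]
    {A : Finset (Vec d)} (u : κ → {x // x ∈ A}) (r : κ → ℝ) (f : {x // x ∈ A} → V) :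
    ∑ x : {x // x ∈ A}, (∑ j, if (u j).1 = x.1 then r j else 0) • f x = ∑ j, r j • f (u j) := by
  simp only [Finset.sum_smul]
  rw [Finset.sum_comm]
  refine Finset.sum_congr rfl fun j _ => ?_
  rw [Finset.sum_eq_single (u j)]
  · simp
  · intro x _ hx
    have : (u j).1 ≠ x.1 := fun h => hx (Subtype.ext h.symm)
    simp [this]
  · simp

variable {R T l A} {D : Finset (Vec d)}

lemma Rules.Valid.mem_of_mem_pulls (hR : R.Valid T D) (hl : 1 ≤ l) (hA : A ⊆ D)
    (hne : A.Nonempty) {i : Fin M} {x : Vec d} (hx : x ∈ R.pulls T l A i) : x ∈ A := by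
  by_contra h
  exact (hR.mem_arms l A hl hA hne x).1 (R.mem_arms_of_mem_pulls T l A hx)
    ((hR.isDesign l A hl hA hne).eq_zero x h)

lemma Rules.Valid.pullCount_eq_zero (hR : R.Valid T D) (hl : 1 ≤ l) (hA : A ⊆ D)
    (hne : A.Nonempty) {x : Vec d} (hx : x ∉ R.arms l A) : R.pullCount T l A x = 0 := by
  have : R.design l A x = 0 := by
    by_contra h
    exact hx ((hR.mem_arms l A hl hA hne x).2 h)
  simp [Rules.pullCount, this]

/-- If no coordinate of the noise of the phase exceeds `√(300 log (MT))` standard deviations, the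
estimate is accurate on the active actions. -/
theorem Rules.Valid.exists_estimate_error (hR : R.Valid T D) (hl : 1 ≤ l) (hA : A ⊆ D)
    (hne : A.Nonempty) (hd : 1 ≤ d) (hM : 1 ≤ M) (hK : 0 < Real.log ((M : ℝ) * T)) :
    ∃ a : Fin (Module.finrank ℝ (actionSpan A)) → R.Slot T l A → ℝ,
      ∀ (θ : Vec d) (e : ℕ → Fin M → ℝ) (τ : ℕ),
      (∀ i, |∑ j, a i j * e (τ + j.2) j.1| ≤
        √(300 * Real.log ((M : ℝ) * T)) * √(∑ j, a i j ^ 2)) →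
      ∀ x ∈ A, |inner ℝ x (R.phaseEstimate T θ e l A τ - θ)| ≤ (1 / 2 : ℝ) ^ l := by
  set K := Real.log ((M : ℝ) * T)
  have hdes := hR.isDesign l A hl hA hne
  have hd0 : (0 : ℝ) < d := by exact_mod_cast hd
  set c : ℝ := 600 * (4 : ℝ) ^ l * (d : ℝ) ^ 2 * K with hc
  have hc0 : 0 < c := by positivity
  let u : R.Slot T l A → {x // x ∈ A} := fun j =>
    ⟨R.slotArm T l A j, hR.mem_of_mem_pulls hl hA hne (List.getElem_mem _)⟩
  have hm : ∀ x, c * R.design l A x ≤ R.pullCount T l A x := by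
    intro x
    refine le_trans (le_of_eq ?_) (Nat.le_ceil _)
    rw [hc]; ring
  have hcount : ∀ x : Vec d, (R.pullCount T l A x : ℝ) =
      ∑ j, if (u j).1 = x then (1 : ℝ) else 0 := by
    intro x
    have h := R.sum_pulls_eq T l A hM (hR.nodup l A hl hA hne) (x := x)
      (hR.pullCount_eq_zero hl hA hne)
    rw [← R.sum_slot T l A fun _ _ y => if y = x then 1 else 0] at h
    rw [← h]
    push_cast
    rfl
  set U : R.Slot T l A → actionSpan A := fun j => inSpan A (u j)
  have hgram : gram A (fun x => (R.pullCount T l A x : ℝ)) =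
      weightedGram (fun _ => (1 : ℝ)) U := by
    simp only [gram, hcount, weightedGram]
    exact sum_subtype_smul u (fun _ => 1)
      (fun x => (InnerProductSpace.rankOne ℝ (inSpan A x) (inSpan A x)).toLinearMap)
  have hdu : IsUnit (weightedGram (fun x : {x // x ∈ A} => R.design l A x.1) (inSpan A)) :=
    hdes.isUnit
  have hwgram : weightedGram (fun x : {x // x ∈ A} => (R.pullCount T l A x.1 : ℝ)) (inSpan A) =
      weightedGram (fun _ => (1 : ℝ)) U := hgram
  have hunit : IsUnit (weightedGram (fun _ => (1 : ℝ)) U) := by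
    rw [← hwgram]
    exact isUnit_weightedGram_of_le hc0 (fun x => hdes.nonneg x.1) (fun x => hm x.1) hdu
  obtain ⟨a, ha⟩ := exists_coordinates U hunit
  refine ⟨a, fun θ e τ he x hx => ?_⟩
  set η : R.Slot T l A → ℝ := fun j => e (τ + j.2) j.1
  have hreward : ∀ x : Vec d, (R.pullCount T l A x : ℝ) *
      R.average T l A (R.phaseReport T θ e l A τ) x =
        ∑ j, if (u j).1 = x then (inner ℝ (u j).1 θ + η j) else 0 := by
    intro x
    have hs := R.sum_slot T l A fun i s y => if y = x then inner ℝ y θ + e (τ + s) i else 0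
    -- The average of an arm without pulls is a division by zero; no slot carries such an arm, so
    -- both sides vanish.
    by_cases h0 : R.pullCount T l A x = 0
    · have h1 := hcount x
      rw [h0, Nat.cast_zero] at h1
      have h2 := (Finset.sum_eq_zero_iff_of_nonneg fun j _ => by split_ifs <;> norm_num).1 h1.symm
      rw [h0, Nat.cast_zero, zero_mul, Finset.sum_eq_zero]
      intro j hj
      have := h2 j hj
      split_ifs with h
      · simp [h] at this
      · rfl
    · rw [R.pullCount_mul_average T l A θ e τ h0, ← hs]
  -- Active actions see only the orthogonal projection of `θ` to their span, and that is what the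
  -- phase estimates.
  obtain ⟨θp, hθp⟩ : ∃ θp : actionSpan A, ∀ z : actionSpan A, inner ℝ z θp = inner ℝ z.1 θ :=
    ⟨(actionSpan A).orthogonalProjectionOnto θ, fun z =>
      Submodule.inner_orthogonalProjectionOnto_eq_of_mem_left z θ⟩
  set V := weightedGram (fun _ => (1 : ℝ)) U with hV
  have hest : R.phaseEstimate T θ e l A τ =
      ((θp + Ring.inverse V (∑ j, η j • U j) : actionSpan A) : Vec d) := by
    rw [Rules.phaseEstimate, Rules.estimate, hgram]
    congr 1
    refine inverse_apply_of_apply_eq hunit ?_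
    rw [map_add, apply_inverse_apply hunit, weightedGram_apply]
    simp only [hreward]
    refine Eq.trans ?_ (sum_subtype_smul u _ (inSpan A)).symm
    rw [← Finset.sum_add_distrib]
    refine Finset.sum_congr rfl fun j _ => ?_
    rw [add_smul, one_mul, hθp]
    rfl
  set X := inSpan A ⟨x, hx⟩
  have herr : inner ℝ x (R.phaseEstimate T θ e l A τ - θ) =
      inner ℝ X (Ring.inverse V (∑ j, η j • U j)) := by
    rw [hest, inner_sub_right, Submodule.coe_add, inner_add_right]
    have h1 : inner ℝ x (θp : Vec d) = inner ℝ x θ := hθp X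
    rw [h1, add_sub_cancel_left]
    rfl
  have h1 := ha η _ (Real.sqrt_nonneg _) he X
  rw [Real.sq_sqrt (by positivity)] at h1
  have h2 : c * inner ℝ X (Ring.inverse V X) ≤ 2 * d := by
    have h := mul_inner_inverse_le hc0 (fun x : {x // x ∈ A} => hdes.nonneg x.1)
      (fun x => hm x.1) hdu X
    rw [hwgram] at h
    exact h.trans (hdes.le_two_mul ⟨x, hx⟩)
  have hk : (Module.finrank ℝ (actionSpan A) : ℝ) ≤ d := by
    have : Module.finrank ℝ (actionSpan A) ≤ d := by simpa using Submodule.finrank_le (actionSpan A)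
    exact_mod_cast this
  have hq0 : 0 ≤ inner ℝ X (Ring.inverse V X) :=
    inner_inverse_nonneg (fun _ => zero_le_one) hunit X
  rw [herr]
  refine abs_le_of_sq_le_sq ?_ (by positivity)
  refine h1.trans ?_
  have h3 : inner ℝ X (Ring.inverse V X) ≤ 2 * d / c := by
    rw [le_div_iff₀ hc0, mul_comm]; exact h2
  -- Leverage `2d / c`, at most `d` coordinates and squared deviation `300 K`: the constant 600
  -- makes the product exactly `4^{-l}`.
  calc _ ≤ 2 * d / c * (d * (300 * K)) := by gcongr
    _ = ((1 / 2 : ℝ) ^ l) ^ 2 := by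
      have h4 : (4 : ℝ) ^ l = (2 ^ l) ^ 2 := by rw [← pow_mul, mul_comm, pow_mul]; norm_num
      rw [hc, h4, div_pow, one_pow]
      field_simp
      norm_num

end Phase

end DELB

/-! ### Phase lengths, elimination and the regret of an accurate run. -/

namespace DELB

section Quota

variable {d M T l : ℕ} {R : Rules d M} {A D : Finset (Vec d)}

lemma one_le_log_mul (hM : 1 ≤ M) (hT : 3 ≤ T) : 1 ≤ Real.log ((M : ℝ) * T) := by
  have h1 : (1 : ℝ) ≤ M := by exact_mod_cast hM
  have h2 : (3 : ℝ) ≤ T := by exact_mod_cast hT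
  have : Real.log 3 ≤ Real.log ((M : ℝ) * T) := Real.log_le_log (by norm_num) (by nlinarith)
  linarith [le_log_three]

lemma one_le_log (hT : 3 ≤ T) : 1 ≤ Real.log T := by
  simpa using one_le_log_mul le_rfl hT

lemma log_mul_le (hM : 1 ≤ M) (hT : M < T) : Real.log ((M : ℝ) * T) ≤ 2 * Real.log T := by
  have h1 : (1 : ℝ) ≤ M := by exact_mod_cast hM
  have h2 : (M : ℝ) ≤ T := by exact_mod_cast hT.le
  rw [Real.log_mul (by linarith) (by linarith)]
  linarith [Real.log_le_log (by linarith) h2]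

lemma Rules.Valid.length_arms_le (hR : R.Valid T D) (hl : 1 ≤ l) (hA : A ⊆ D)
    (hne : A.Nonempty) :
    ((R.arms l A).length : ℝ) ≤ 48 * d * Real.log (Real.log d) := by
  refine le_trans (le_of_eq ?_) (hR.isDesign l A hl hA hne).support_card
  have h : Function.support (R.design l A) = ((R.arms l A).toFinset : Set (Vec d)) := by
    ext x
    simp [hR.mem_arms l A hl hA hne]
  rw [h, Set.ncard_coe_finset, List.toFinset_card_of_nodup (hR.nodup l A hl hA hne)]

lemma Rules.Valid.cumPulls_bounds (hR : R.Valid T D) (hl : 1 ≤ l) (hA : A ⊆ D)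
    (hne : A.Nonempty) (hK : 0 ≤ Real.log ((M : ℝ) * T)) :
    600 * (4 : ℝ) ^ l * (d : ℝ) ^ 2 * Real.log ((M : ℝ) * T) ≤
        R.cumPulls T l A (R.arms l A).length ∧
      (R.cumPulls T l A (R.arms l A).length : ℝ) ≤
        600 * (4 : ℝ) ^ l * (d : ℝ) ^ 2 * Real.log ((M : ℝ) * T) + (R.arms l A).length := by
  have hdes := hR.isDesign l A hl hA hne
  have hnd := hR.nodup l A hl hA hne
  set c := 600 * (4 : ℝ) ^ l * (d : ℝ) ^ 2 * Real.log ((M : ℝ) * T) with hc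
  have hc0 : 0 ≤ c := by positivity
  have htot : (R.cumPulls T l A (R.arms l A).length : ℝ) =
      ∑ x ∈ (R.arms l A).toFinset, (R.pullCount T l A x : ℝ) := by
    rw [Rules.cumPulls, List.take_length, ← List.sum_toFinset _ hnd]
    push_cast
    rfl
  have hone : ∑ x ∈ (R.arms l A).toFinset, R.design l A x = 1 := by
    rw [← hdes.sum_eq_one]
    refine Finset.sum_subset (fun x hx => ?_) fun x _ hx => ?_
    · by_contra h
      exact (hR.mem_arms l A hl hA hne x).1 (List.mem_toFinset.1 hx) (hdes.eq_zero x h)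
    · by_contra h
      exact hx (List.mem_toFinset.2 ((hR.mem_arms l A hl hA hne x).2 h))
  have hm : ∀ x, R.pullCount T l A x = ⌈c * R.design l A x⌉₊ := by
    intro x
    rw [Rules.pullCount, hc]
    congr 1
    ring
  have hcsum : c = ∑ x ∈ (R.arms l A).toFinset, c * R.design l A x := by
    rw [← Finset.mul_sum, hone, mul_one]
  have hcard : ((R.arms l A).length : ℝ) = ∑ x ∈ (R.arms l A).toFinset, (1 : ℝ) := by
    rw [Finset.sum_const, List.toFinset_card_of_nodup hnd, nsmul_eq_mul, mul_one]
  rw [htot]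
  constructor
  · conv_lhs => rw [hcsum]
    exact Finset.sum_le_sum fun x _ => by rw [hm]; exact Nat.le_ceil _
  · rw [hcard]
    conv_rhs => rw [hcsum]
    rw [← Finset.sum_add_distrib]
    refine Finset.sum_le_sum fun x _ => ?_
    rw [hm]
    exact (Nat.ceil_lt_add_one (mul_nonneg hc0 (hdes.nonneg x))).le

lemma Rules.Valid.le_mul_quota (hR : R.Valid T D) (hl : 1 ≤ l) (hA : A ⊆ D)
    (hne : A.Nonempty) (hM : 1 ≤ M) (hK : 0 ≤ Real.log ((M : ℝ) * T)) :
    600 * (4 : ℝ) ^ l * (d : ℝ) ^ 2 * Real.log ((M : ℝ) * T) ≤ M * R.quota T l A := by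
  refine (hR.cumPulls_bounds hl hA hne hK).1.trans ?_
  exact_mod_cast R.cumPulls_length_le T l A hM

lemma Rules.Valid.quota_pos (hR : R.Valid T D) (hl : 1 ≤ l) (hA : A ⊆ D)
    (hne : A.Nonempty) (hd : 3 ≤ d) (hM : 1 ≤ M) (hT : 3 ≤ T) : 1 ≤ R.quota T l A := by
  have hK := one_le_log_mul hM hT
  have h := hR.le_mul_quota hl hA hne hM (by linarith)
  by_contra! h0
  have h0 : R.quota T l A = 0 := by omega
  rw [h0, Nat.cast_zero, mul_zero] at h
  have hd0 : (0 : ℝ) < d := by exact_mod_cast (by omega : 0 < d)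
  have : 0 < 600 * (4 : ℝ) ^ l * (d : ℝ) ^ 2 * Real.log ((M : ℝ) * T) := by positivity
  linarith

lemma Rules.Valid.quota_le (hR : R.Valid T D) (hl : 1 ≤ l) (hA : A ⊆ D)
    (hne : A.Nonempty) (hd : 3 ≤ d) (hM : 1 ≤ M) (hT : 3 ≤ T) :
    (R.quota T l A : ℝ) ≤
      648 * (4 : ℝ) ^ l * ((d : ℝ) ^ 2 * Real.log ((M : ℝ) * T) / M) + 1 := by
  have hK := one_le_log_mul hM hT
  have hM0 : (0 : ℝ) < M := by exact_mod_cast hM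
  have hd3 : (3 : ℝ) ≤ d := by exact_mod_cast hd
  have hN := hR.length_arms_le hl hA hne
  have hll : Real.log (Real.log d) ≤ d := by
    have h1 : Real.log d ≤ d := (Real.log_le_sub_one_of_pos (by linarith)).trans (by linarith)
    have h0 : 0 < Real.log d := Real.log_pos (by linarith)
    exact ((Real.log_le_sub_one_of_pos h0).trans (by linarith)).trans h1
  have hb := (hR.cumPulls_bounds hl hA hne (by linarith)).2
  set K := Real.log ((M : ℝ) * T)
  have h4 : (1 : ℝ) ≤ 4 ^ l := one_le_pow₀ (by norm_num)
  -- Rounding up costs one pull per arm, at most `48 d ^ 2` in all by the crude bound `log log d ≤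
  -- d`; hence `648 = 600 + 48`.
  have hN' : ((R.arms l A).length : ℝ) ≤ 48 * (4 : ℝ) ^ l * (d : ℝ) ^ 2 * K := by
    calc ((R.arms l A).length : ℝ) ≤ 48 * d * d := hN.trans (by gcongr)
      _ = 48 * 1 * (d : ℝ) ^ 2 * 1 := by ring
      _ ≤ _ := by gcongr
  refine (Nat.ceil_lt_add_one (by positivity)).le.trans ?_
  have : (R.cumPulls T l A (R.arms l A).length : ℝ) / M ≤
      (648 * (4 : ℝ) ^ l * (d : ℝ) ^ 2 * K) / M := by
    gcongr
    linarith
  calc _ ≤ (648 * (4 : ℝ) ^ l * (d : ℝ) ^ 2 * K) / M + 1 := by linarith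
    _ = _ := by ring

end Quota

section Run

variable {d M T : ℕ} {R : Rules d M} {D : Finset (Vec d)} {θ : Vec d} {e : ℕ → Fin M → ℝ}

lemma mem_eliminate {l : ℕ} {A : Finset (Vec d)} {v x : Vec d} :
    x ∈ eliminate l A v ↔
      x ∈ A ∧ ∀ b ∈ A, inner ℝ v (b - x) ≤ (2 : ℝ) ^ (-(l : ℤ) + 1) := by
  simp [eliminate]

lemma eliminate_nonempty {l : ℕ} {A : Finset (Vec d)} (hA : A.Nonempty) (v : Vec d) :
    (eliminate l A v).Nonempty := by
  -- The action that looks best under the estimate always survives.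
  obtain ⟨x, hx, hmax⟩ := A.exists_max_image (fun x => inner ℝ v x) hA
  refine ⟨x, mem_eliminate.2 ⟨hx, fun b hb => ?_⟩⟩
  rw [inner_sub_right]
  exact (sub_nonpos.2 (hmax b hb)).trans (by positivity)

lemma Rules.phase_fst (hD : D.Nonempty) (n : ℕ) :
    (R.phase T D θ e n).1 ⊆ D ∧ (R.phase T D θ e n).1.Nonempty := by
  induction n with
  | zero => exact ⟨subset_rfl, hD⟩
  | succ n ih =>
    exact ⟨fun x hx => ih.1 (mem_eliminate.1 hx).1, eliminate_nonempty ih.2 _⟩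

lemma Rules.phase_succ_snd (n : ℕ) : (R.phase T D θ e (n + 1)).2 =
    (R.phase T D θ e n).2 + R.quota T (n + 1) (R.phase T D θ e n).1 := rfl

lemma Rules.Valid.lt_phase_succ_snd (hR : R.Valid T D) (hD : D.Nonempty) (hd : 3 ≤ d)
    (hM : 1 ≤ M) (hT : 3 ≤ T) (n : ℕ) :
    (R.phase T D θ e n).2 < (R.phase T D θ e (n + 1)).2 := by
  obtain ⟨h1, h2⟩ := R.phase_fst (T := T) (θ := θ) (e := e) hD n
  have := hR.quota_pos (Nat.le_add_left 1 n) h1 h2 hd hM hT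
  rw [R.phase_succ_snd]
  omega

lemma Rules.Valid.le_phase_snd (hR : R.Valid T D) (hD : D.Nonempty) (hd : 3 ≤ d)
    (hM : 1 ≤ M) (hT : 3 ≤ T) (n : ℕ) : n ≤ (R.phase T D θ e n).2 := by
  induction n with
  | zero => exact Nat.zero_le _
  | succ n ih => exact Nat.succ_le_of_lt (ih.trans_lt (hR.lt_phase_succ_snd hD hd hM hT n))

/-- Geometric sum with `864 = 648 * 4 / 3`; the summand `n` collects the roundings of the phase
lengths. -/
lemma Rules.Valid.phase_snd_le (hR : R.Valid T D) (hD : D.Nonempty) (hd : 3 ≤ d)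
    (hM : 1 ≤ M) (hT : 3 ≤ T) (n : ℕ) : ((R.phase T D θ e n).2 : ℝ) ≤
      864 * (4 : ℝ) ^ n * ((d : ℝ) ^ 2 * Real.log ((M : ℝ) * T) / M) + n := by
  have hK := one_le_log_mul hM hT
  have ha : 0 ≤ (d : ℝ) ^ 2 * Real.log ((M : ℝ) * T) / M := by positivity
  induction n with
  | zero => simp only [Rules.phase, Nat.cast_zero]; positivity
  | succ n ih =>
    obtain ⟨h1, h2⟩ := R.phase_fst (T := T) (θ := θ) (e := e) hD n
    have := hR.quota_le (Nat.le_add_left 1 n) h1 h2 hd hM hT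
    rw [R.phase_succ_snd]
    push_cast
    rw [pow_succ] at this ⊢
    linarith

lemma Rules.Valid.le_phase_succ_snd (hR : R.Valid T D) (hD : D.Nonempty)
    (hM : 1 ≤ M) (hT : 3 ≤ T) (n : ℕ) :
    600 * (4 : ℝ) ^ (n + 1) * (d : ℝ) ^ 2 * Real.log ((M : ℝ) * T) ≤
      M * (R.phase T D θ e (n + 1)).2 := by
  have hK := one_le_log_mul hM hT
  obtain ⟨h1, h2⟩ := R.phase_fst (T := T) (θ := θ) (e := e) hD n
  refine (hR.le_mul_quota (Nat.le_add_left 1 n) h1 h2 hM (by linarith)).trans ?_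
  rw [R.phase_succ_snd]
  gcongr
  exact Nat.le_add_left _ _

/-- The search bound `t` in `phaseAt` is harmless because phases last at least one step. -/
lemma Rules.Valid.lt_phase_phaseAt (hR : R.Valid T D) (hD : D.Nonempty) (hd : 3 ≤ d)
    (hM : 1 ≤ M) (hT : 3 ≤ T) (t : ℕ) :
    t < (R.phase T D θ e (R.phaseAt T D θ e t + 1)).2 := by
  by_contra! h
  have h1 := (hR.le_phase_snd (θ := θ) (e := e) hD hd hM hT (R.phaseAt T D θ e t + 1)).trans h
  have h2 : R.phaseAt T D θ e t + 1 ≤ R.phaseAt T D θ e t :=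
    Nat.le_findGreatest (P := fun n => (R.phase T D θ e n).2 ≤ t) h1 h
  omega

lemma Rules.phaseAt_le (t : ℕ) : R.phaseAt T D θ e t ≤ t := Nat.findGreatest_le t

lemma Rules.Valid.action_mem (hR : R.Valid T D) (hD : D.Nonempty) (t : ℕ) (i : Fin M) :
    R.action T D θ e t i ∈ (R.phase T D θ e (R.phaseAt T D θ e t)).1 := by
  obtain ⟨h1, h2⟩ := R.phase_fst (T := T) (θ := θ) (e := e) hD (R.phaseAt T D θ e t)
  simp only [Rules.action]
  set n := R.phaseAt T D θ e t
  set A := (R.phase T D θ e n).1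
  set s := t - (R.phase T D θ e n).2
  by_cases hs : s < (R.pulls T (n + 1) A i).length
  · rw [R.play_of_lt T (n + 1) A i hs, List.getD_eq_getElem _ _ hs]
    exact hR.mem_of_mem_pulls (Nat.le_add_left 1 n) h1 h2 (List.getElem_mem _)
  · have : R.play (n + 1) A i (R.assignment T (n + 1) A i) s = R.idle (n + 1) A i s :=
      List.getD_eq_default _ _ (not_lt.1 hs)
    rw [this]
    exact hR.idle_mem (n + 1) A (Nat.le_add_left 1 n) h1 h2 i s

/-- The estimate of phase `n + 1` is accurate on the active actions. -/
def Rules.Accurate (R : Rules d M) (T : ℕ) (D : Finset (Vec d)) (θ : Vec d) (e : ℕ → Fin M → ℝ)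
    (n : ℕ) : Prop :=
  ∀ x ∈ (R.phase T D θ e n).1,
    |inner ℝ x (R.phaseEstimate T θ e (n + 1) (R.phase T D θ e n).1 (R.phase T D θ e n).2 - θ)|
      ≤ (1 / 2 : ℝ) ^ (n + 1)

lemma inner_le_of_norm_le_one {x y : Vec d} (hx : ‖x‖ ≤ 1) (hy : ‖y‖ ≤ 1) : |inner ℝ x y| ≤ 1 :=
  (abs_real_inner_le_norm x y).trans (mul_le_one₀ hx (norm_nonneg _) hy)

lemma two_zpow_eq (n : ℕ) : (2 : ℝ) ^ (-((n + 1 : ℕ) : ℤ) + 1) = (1 / 2) ^ n := by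
  have : -((n + 1 : ℕ) : ℤ) + 1 = -(n : ℤ) := by push_cast; ring
  rw [this, zpow_neg, zpow_natCast, one_div, inv_pow]

/-- While the estimates are accurate, the optimal action stays active and the suboptimal ones are
eliminated at a geometric rate. -/
lemma Rules.gap_le (hDn : ∀ x ∈ D, ‖x‖ ≤ 1) (hθ : ‖θ‖ ≤ 1) {b : Vec d} (hb : b ∈ D)
    (hmax : ∀ x ∈ D, inner ℝ x θ ≤ inner ℝ b θ) {n : ℕ}
    (hacc : ∀ k < n, R.Accurate T D θ e k) :
    b ∈ (R.phase T D θ e n).1 ∧ (R.phase T D θ e n).1 ⊆ D ∧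
      ∀ x ∈ (R.phase T D θ e n).1, inner ℝ b θ - inner ℝ x θ ≤ 4 * (1 / 2 : ℝ) ^ n := by
  induction n with
  | zero =>
    refine ⟨hb, subset_rfl, fun x hx => ?_⟩
    have h1 := abs_le.1 (inner_le_of_norm_le_one (hDn b hb) hθ)
    have h2 := abs_le.1 (inner_le_of_norm_le_one (hDn x hx) hθ)
    norm_num
    linarith [h1.2, h2.1]
  | succ n ih =>
    obtain ⟨hbA, hsub, -⟩ := ih fun k hk => hacc k (by omega)
    have h := hacc n (by omega)
    rw [Rules.Accurate] at h
    have hphase : (R.phase T D θ e (n + 1)).1 = eliminate (n + 1) (R.phase T D θ e n).1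
      (R.phaseEstimate T θ e (n + 1) (R.phase T D θ e n).1 (R.phase T D θ e n).2) := rfl
    rw [hphase]
    set A := (R.phase T D θ e n).1
    set v := R.phaseEstimate T θ e (n + 1) A (R.phase T D θ e n).2
    -- The errors at two actions add up to at most `(1 / 2) ^ n`, which is the elimination
    -- threshold. So `b` survives, and a survivor has gap at most twice the threshold.
    have hhalf : (1 / 2 : ℝ) ^ (n + 1) = (1 / 2) ^ n / 2 := by rw [pow_succ]; ring
    have hbv := abs_le.1 (h b hbA)
    rw [inner_sub_right, hhalf] at hbv
    refine ⟨mem_eliminate.2 ⟨hbA, fun x hx => ?_⟩, fun x hx => hsub (mem_eliminate.1 hx).1,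
      fun x hx => ?_⟩
    · have hxv := abs_le.1 (h x hx)
      rw [inner_sub_right, hhalf] at hxv
      rw [two_zpow_eq, inner_sub_right, real_inner_comm, real_inner_comm b]
      linarith [hmax x (hsub hx), hxv.2, hbv.1]
    · obtain ⟨hxA, hx⟩ := mem_eliminate.1 hx
      have hxv := abs_le.1 (h x hxA)
      rw [inner_sub_right, hhalf] at hxv
      have := hx b hbA
      rw [two_zpow_eq, inner_sub_right, real_inner_comm, real_inner_comm x] at this
      rw [hhalf]
      linarith [hbv.1, hxv.2]

lemma Rules.Valid.regret_term (hR : R.Valid T D) (hD : D.Nonempty) (hDn : ∀ x ∈ D, ‖x‖ ≤ 1)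
    (hθ : ‖θ‖ ≤ 1) (t : ℕ) (i : Fin M) :
    0 ≤ D.sup' hD (fun x => inner ℝ x θ) - inner ℝ (R.action T D θ e t i) θ ∧
      D.sup' hD (fun x => inner ℝ x θ) - inner ℝ (R.action T D θ e t i) θ ≤ 2 := by
  have hmem := (R.phase_fst (T := T) (θ := θ) (e := e) hD _).1
    (hR.action_mem (θ := θ) (e := e) hD t i)
  have h1 := abs_le.1 (inner_le_of_norm_le_one (hDn _ hmem) hθ)
  have h2 : D.sup' hD (fun x => inner ℝ x θ) ≤ 1 := Finset.sup'_le hD _ fun x hx =>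
    (abs_le.1 (inner_le_of_norm_le_one (hDn x hx) hθ)).2
  exact ⟨sub_nonneg.2 (Finset.le_sup' (fun x => inner ℝ x θ) hmem), by linarith [h1.1]⟩

lemma Rules.Valid.regret_bounds (hR : R.Valid T D) (hD : D.Nonempty) (hDn : ∀ x ∈ D, ‖x‖ ≤ 1)
    (hθ : ‖θ‖ ≤ 1) : 0 ≤ R.regret T D hD θ e ∧ R.regret T D hD θ e ≤ 2 * (M * T) := by
  have h := fun t i => hR.regret_term (e := e) hD hDn hθ t i
  refine ⟨Finset.sum_nonneg fun t _ => Finset.sum_nonneg fun i _ => (h t i).1, ?_⟩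
  refine (Finset.sum_le_sum fun t _ => Finset.sum_le_sum fun i _ => (h t i).2).trans ?_
  simp
  linarith

lemma sum_inv_sqrt_le (n : ℕ) : ∑ t ∈ Finset.range n, 1 / √((t : ℝ) + 1) ≤ 2 * √n := by
  induction n with
  | zero => simp
  | succ n ih =>
    rw [Finset.sum_range_succ]
    push_cast
    have h0 : (0 : ℝ) ≤ n := Nat.cast_nonneg n
    have h1 : √((n : ℝ) + 1) ^ 2 = n + 1 := Real.sq_sqrt (by positivity)
    have h2 : √(n : ℝ) ^ 2 = n := Real.sq_sqrt h0
    have h3 : 0 < √((n : ℝ) + 1) := Real.sqrt_pos.2 (by positivity)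
    have h4 : 1 / √((n : ℝ) + 1) ≤ 2 * √((n : ℝ) + 1) - 2 * √n := by
      rw [div_le_iff₀ h3]
      nlinarith [sq_nonneg (√((n : ℝ) + 1) - √n)]
    linarith

/-- The rounding term `n + 1` matters when there are many agents. If `t ≤ 2n`, then `2^{-n}` is at
most the summable `(3/4)^t`; otherwise `n + 1` is at most half of `t + 1`, which doubles 3456 to
`6912 ≤ 84 ^ 2`. -/
lemma half_pow_le {n t : ℕ} {a : ℝ} (ha : 0 ≤ a) (h : (t : ℝ) + 1 ≤ 3456 * 4 ^ n * a + (n + 1)) :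
    (1 / 2 : ℝ) ^ n ≤ 84 * √a * (1 / √((t : ℝ) + 1)) + (3 / 4) ^ t := by
  have ht : (0 : ℝ) < (t : ℝ) + 1 := by positivity
  rcases le_or_gt t (2 * n) with hn | hn
  · have h1 : (1 / 2 : ℝ) ^ n ≤ (3 / 4) ^ t := by
      calc (1 / 2 : ℝ) ^ n ≤ (9 / 16) ^ n :=
          pow_le_pow_left₀ (by norm_num) (by norm_num) n
        _ = (3 / 4) ^ (2 * n) := by rw [pow_mul]; norm_num
        _ ≤ (3 / 4) ^ t := pow_le_pow_of_le_one (by norm_num) (by norm_num) hn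
    have : 0 ≤ 84 * √a * (1 / √((t : ℝ) + 1)) := by positivity
    linarith
  · have hn' : (2 : ℝ) * n + 1 ≤ t := by exact_mod_cast hn
    have h1 : (t : ℝ) + 1 ≤ 6912 * 4 ^ n * a := by linarith
    have h2 : √((t : ℝ) + 1) ≤ 84 * 2 ^ n * √a := by
      rw [Real.sqrt_le_left (by positivity), mul_pow, Real.sq_sqrt ha]
      have h4 : ((2 : ℝ) ^ n) ^ 2 = 4 ^ n := by rw [← pow_mul, mul_comm, pow_mul]; norm_num
      rw [mul_pow, h4]
      have : 0 ≤ (4 : ℝ) ^ n * a := by positivity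
      nlinarith
    have h3 : (1 / 2 : ℝ) ^ n ≤ 84 * √a * (1 / √((t : ℝ) + 1)) := by
      rw [mul_one_div, le_div_iff₀ (Real.sqrt_pos.2 ht), one_div, inv_pow,
        inv_mul_le_iff₀ (by positivity)]
      linarith
    have : (0 : ℝ) ≤ (3 / 4) ^ t := by positivity
    linarith

/-- The regret of a run in which all estimates are accurate. -/
theorem Rules.Valid.regret_le (hR : R.Valid T D) (hD : D.Nonempty) (hDn : ∀ x ∈ D, ‖x‖ ≤ 1)
    (hθ : ‖θ‖ ≤ 1) (hd : 3 ≤ d) (hM : 1 ≤ M) (hMT : M < T) (hT : 3 ≤ T)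
    (hacc : ∀ n < T, R.Accurate T D θ e n) :
    R.regret T D hD θ e ≤ 1024 * (d * √((T : ℝ) * M * Real.log T)) := by
  have hK := one_le_log_mul hM hT
  have hL := one_le_log hT
  have hKL := log_mul_le hM hMT
  have hM0 : (0 : ℝ) < M := by exact_mod_cast hM
  have hd1 : (1 : ℝ) ≤ d := by exact_mod_cast (by omega : 1 ≤ d)
  set K := Real.log ((M : ℝ) * T)
  set a : ℝ := (d : ℝ) ^ 2 * K / M with ha
  have ha0 : 0 ≤ a := by positivity
  obtain ⟨b, hb, hmax⟩ := D.exists_max_image (fun x => inner ℝ x θ) hD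
  have hsup : D.sup' hD (fun x => inner ℝ x θ) = inner ℝ b θ :=
    le_antisymm (Finset.sup'_le hD _ hmax) (Finset.le_sup' (fun x => inner ℝ x θ) hb)
  have hterm : ∀ t ∈ Finset.range T, ∀ i ∈ (Finset.univ : Finset (Fin M)),
      D.sup' hD (fun x => inner ℝ x θ) - inner ℝ (R.action T D θ e t i) θ ≤
        336 * √a * (1 / √((t : ℝ) + 1)) + 4 * (3 / 4) ^ t := by
    intro t ht i _
    rw [Finset.mem_range] at ht
    set n := R.phaseAt T D θ e t with hn
    have hnt : n ≤ t := R.phaseAt_le t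
    have hgap := (R.gap_le hDn hθ hb hmax (n := n) fun k hk => hacc k (by omega)).2.2 _
      (hR.action_mem hD t i)
    rw [hsup]
    refine hgap.trans ?_
    have h1 : ((t + 1 : ℕ) : ℝ) ≤ (R.phase T D θ e (n + 1)).2 := by
      exact_mod_cast hR.lt_phase_phaseAt hD hd hM hT t
    have h2 := hR.phase_snd_le (θ := θ) (e := e) hD hd hM hT (n + 1)
    have h3 : (t : ℝ) + 1 ≤ 3456 * 4 ^ n * a + (n + 1) := by
      push_cast at h1 h2
      rw [pow_succ] at h2
      linarith
    linarith [half_pow_le ha0 h3]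
  have hgeom : ∑ t ∈ Finset.range T, (3 / 4 : ℝ) ^ t ≤ 4 := by
    rw [geom_sum_eq (by norm_num)]
    have : (0 : ℝ) ≤ (3 / 4) ^ T := by positivity
    rw [div_le_iff_of_neg (by norm_num)]
    linarith
  have hsum : R.regret T D hD θ e ≤ M * (336 * √a * (2 * √T) + 16) := by
    refine (Finset.sum_le_sum fun t ht => Finset.sum_le_sum fun i hi => hterm t ht i hi).trans ?_
    simp only [Finset.sum_const, Finset.card_univ, Fintype.card_fin, nsmul_eq_mul]
    rw [← Finset.mul_sum, Finset.sum_add_distrib, ← Finset.mul_sum, ← Finset.mul_sum]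
    have := sum_inv_sqrt_le T
    have h0 : 0 ≤ 336 * √a := by positivity
    gcongr
    linarith
  set Q := √((T : ℝ) * M * Real.log T) with hQ
  have hT0 : (0 : ℝ) ≤ T := Nat.cast_nonneg T
  have hMT' : (M : ℝ) ≤ T := by exact_mod_cast hMT.le
  -- The summable part costs `16 M`, which is absorbed because `M < T`.
  have hMQ : (M : ℝ) ≤ Q := by
    apply Real.le_sqrt_of_sq_le
    have : (M : ℝ) * M ≤ T * M := by gcongr
    nlinarith [mul_nonneg hT0 hM0.le]
  -- `log (MT) ≤ 2 log T` costs `√2 ≤ 3 / 2`, and `672 * 3 / 2 + 16 = 1024`.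
  have hmain : M * (√a * √T) ≤ 3 / 2 * (d * Q) := by
    refine le_of_sq_le_sq ?_ (by positivity)
    rw [mul_pow, mul_pow, Real.sq_sqrt ha0, Real.sq_sqrt hT0, mul_pow, mul_pow,
      hQ, Real.sq_sqrt (by positivity), ha]
    have : (M : ℝ) ^ 2 * ((d : ℝ) ^ 2 * K / M * T) = (d : ℝ) ^ 2 * (T * M) * K := by
      field_simp
    rw [this]
    have h0 : 0 ≤ (d : ℝ) ^ 2 * (T * M) := by positivity
    nlinarith [mul_le_mul_of_nonneg_left hKL h0, mul_nonneg h0 (by linarith : 0 ≤ Real.log T)]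
  have hQ0 : 0 ≤ Q := Real.sqrt_nonneg _
  nlinarith [mul_le_mul_of_nonneg_right hd1 hQ0]

end Run

end DELB

/-! ### Communication cost. -/

namespace DELB

variable {d M T : ℕ} {R : Rules d M} {D : Finset (Vec d)} {θ : Vec d} {e : ℕ → Fin M → ℝ}

/-- The last complete phase alone forces `4 ^ n ≤ M * T ≤ T ^ 2`, so only logarithmically many
phases start in time. -/
lemma Rules.Valid.two_pow_le_of_phase_lt (hR : R.Valid T D) (hD : D.Nonempty) (hd : 3 ≤ d)
    (hM : 1 ≤ M) (hMT : M < T) (hT : 3 ≤ T) {n : ℕ} (hn : (R.phase T D θ e n).2 < T) :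
    (2 : ℝ) ^ n ≤ T := by
  have hT1 : (1 : ℝ) ≤ T := by exact_mod_cast (by omega : 1 ≤ T)
  cases n with
  | zero => simpa using hT1
  | succ n =>
    have hK := one_le_log_mul hM hT
    have h := hR.le_phase_succ_snd (θ := θ) (e := e) hD hM hT n
    have h1 : ((R.phase T D θ e (n + 1)).2 : ℝ) ≤ T := by exact_mod_cast hn.le
    have h2 : (M : ℝ) ≤ T := by exact_mod_cast hMT.le
    have hd1 : (1 : ℝ) ≤ (d : ℝ) ^ 2 := one_le_pow₀ (by exact_mod_cast (by omega : 1 ≤ d))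
    have h3 : (4 : ℝ) ^ (n + 1) ≤ T ^ 2 := by
      calc (4 : ℝ) ^ (n + 1) = 1 * (4 : ℝ) ^ (n + 1) * 1 * 1 := by ring
        _ ≤ 600 * (4 : ℝ) ^ (n + 1) * (d : ℝ) ^ 2 * Real.log ((M : ℝ) * T) := by
          gcongr; norm_num
        _ ≤ M * (R.phase T D θ e (n + 1)).2 := h
        _ ≤ T * T := by gcongr
        _ = T ^ 2 := by ring
    refine le_of_sq_le_sq ?_ (by linarith)
    calc ((2 : ℝ) ^ (n + 1)) ^ 2 = 4 ^ (n + 1) := by rw [← pow_mul, mul_comm, pow_mul]; norm_num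
      _ ≤ T ^ 2 := h3

/-- The communication cost of a run. -/
theorem Rules.Valid.commCost_le (hR : R.Valid T D) (hD : D.Nonempty) (hd : 3 ≤ d)
    (hM : 1 ≤ M) (hMT : M < T) (hT : 3 ≤ T) :
    (R.commCost T D θ e : ℝ) ≤
      1024 * ((M * d + d * Real.log (Real.log d)) * Real.log T) := by
  have hL := one_le_log hT
  have hll := one_div_le_log_log hd
  have hM1 : (1 : ℝ) ≤ M := by exact_mod_cast hM
  have hd3 : (3 : ℝ) ≤ d := by exact_mod_cast hd
  have hT0 : (0 : ℝ) < T := by exact_mod_cast (by omega : 0 < T)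
  -- Two integers and one average per assignment entry, and `d` coordinates of the estimate to each
  -- agent.
  set B : ℝ := 3 * (48 * d * Real.log (Real.log d) + M) + M * d with hB
  have hB0 : 0 ≤ B := by positivity
  have hterm : ∀ n ∈ Finset.range T,
      ((let A := (R.phase T D θ e n).1
        let τ := (R.phase T D θ e n).2
        ((if τ < T then
            ∑ i : Fin M, (assignmentPackets (R.assignment T (n + 1) A i)).length else 0)
          + (if τ + R.quota T (n + 1) A ≤ T then
            ∑ i : Fin M, ((reportPackets (R.phaseReport T θ e (n + 1) A τ i)).length
              + (vectorPackets (R.phaseEstimate T θ e (n + 1) A τ)).length) else 0) : ℕ)) : ℝ) ≤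
        if (2 : ℝ) ^ n ≤ T then B else 0 := by
    intro n _
    obtain ⟨h1, h2⟩ := R.phase_fst (T := T) (θ := θ) (e := e) hD n
    have hlt := hR.lt_phase_succ_snd (θ := θ) (e := e) hD hd hM hT n
    rw [R.phase_succ_snd] at hlt
    have hpow := hR.two_pow_le_of_phase_lt (θ := θ) (e := e) hD hd hM hMT hT (n := n)
    have hN := hR.length_arms_le (Nat.le_add_left 1 n) h1 h2
    have hS := R.sum_length_assignment_le T (n + 1) (R.phase T D θ e n).1
    simp only
    set A := (R.phase T D θ e n).1
    set τ := (R.phase T D θ e n).2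
    have ha : ∑ i : Fin M, (assignmentPackets (R.assignment T (n + 1) A i)).length =
        2 * ∑ i, (R.assignment T (n + 1) A i).length := by
      simp only [length_assignmentPackets, Finset.mul_sum]
    have hr : ∑ i : Fin M, ((reportPackets (R.phaseReport T θ e (n + 1) A τ i)).length
        + (vectorPackets (R.phaseEstimate T θ e (n + 1) A τ)).length) =
        ∑ i, (R.assignment T (n + 1) A i).length + M * d := by
      rw [Finset.sum_add_distrib]
      simp [reportPackets, vectorPackets, Rules.phaseReport, length_report]
    rw [ha, hr]
    by_cases hτ : τ < T
    · rw [if_pos (hpow hτ)]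
      have hS' : ((∑ i, (R.assignment T (n + 1) A i).length : ℕ) : ℝ) ≤
          48 * d * Real.log (Real.log d) + M := by
        refine le_trans (b := (((R.arms (n + 1) A).length + M : ℕ) : ℝ)) (by exact_mod_cast hS) ?_
        push_cast
        linarith
      calc _ ≤ ((2 * ∑ i, (R.assignment T (n + 1) A i).length +
            (∑ i, (R.assignment T (n + 1) A i).length + M * d) : ℕ) : ℝ) := by
            rw [if_pos hτ]
            gcongr
            split_ifs
            · exact le_rfl
            · exact Nat.zero_le _
        _ ≤ B := by
            rw [hB]
            push_cast at hS' ⊢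
            linarith
    -- A phase has positive length, so one that starts at `T` or later is not completed within the
    -- horizon.
    · have hτ' : ¬ τ + R.quota T (n + 1) A ≤ T := by omega
      rw [if_neg hτ, if_neg hτ']
      split_ifs
      · simpa using hB0
      · simp
  -- There are at most `log T / log 2 + 1 ≤ 3 log T` such phases.
  have hcount : ∑ n ∈ Finset.range T, (if (2 : ℝ) ^ n ≤ T then B else 0) ≤
      (3 * Real.log T) * B := by
    rw [← Finset.sum_filter, Finset.sum_const, nsmul_eq_mul]
    gcongr
    set m := ⌊Real.log T / Real.log 2⌋₊ with hm
    have hl2 : 0 < Real.log 2 := Real.log_pos one_lt_two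
    have hsub : (Finset.range T).filter (fun n => (2 : ℝ) ^ n ≤ T) ⊆ Finset.range (m + 1) := by
      intro n hn
      rw [Finset.mem_filter] at hn
      rw [Finset.mem_range, Nat.lt_succ_iff, hm, Nat.le_floor_iff (by positivity),
        le_div_iff₀ hl2, ← Real.log_pow]
      exact Real.log_le_log (by positivity) hn.2
    have h1 : (((Finset.range T).filter (fun n => (2 : ℝ) ^ n ≤ T)).card : ℝ) ≤ m + 1 := by
      exact_mod_cast (Finset.card_le_card hsub).trans (by simp)
    have h2 : (m : ℝ) ≤ Real.log T / Real.log 2 := Nat.floor_le (by positivity)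
    have h3 : Real.log T / Real.log 2 ≤ 2 * Real.log T := by
      rw [div_le_iff₀ hl2]
      nlinarith [Real.log_two_gt_d9]
    linarith
  rw [Rules.commCost, Nat.cast_sum]
  refine (Finset.sum_le_sum hterm).trans (hcount.trans ?_)
  have hB' : 3 * B ≤ 1024 * (M * d + d * Real.log (Real.log d)) := by
    rw [hB]
    have h1 : (M : ℝ) * 3 ≤ M * d := by gcongr
    have h2 : 0 ≤ (d : ℝ) * Real.log (Real.log d) := by positivity
    nlinarith
  calc 3 * Real.log T * B = 3 * B * Real.log T := by ring
    _ ≤ 1024 * (M * d + d * Real.log (Real.log d)) * Real.log T := by gcongr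
    _ = _ := by ring

end DELB

/-! ### Dependence of the run on the noise: locality and measurability. -/

namespace DELB

section Locality

variable {d M T : ℕ} (R : Rules d M) {D : Finset (Vec d)} {θ : Vec d}

lemma Rules.phaseEstimate_congr {e e' : ℕ → Fin M → ℝ} {l τ : ℕ} {A : Finset (Vec d)}
    (h : ∀ t, τ ≤ t → t < τ + R.quota T l A → ∀ i, e t i = e' t i) :
    R.phaseEstimate T θ e l A τ = R.phaseEstimate T θ e' l A τ := by
  rw [Rules.phaseEstimate, Rules.phaseEstimate]
  congr 1
  funext i
  refine report_congr _ fun s hs => ?_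
  rw [← length_expand fun k => (R.arms l A).getD k 0] at hs
  have := hs.trans_le (R.length_pulls_le T l A i)
  rw [h (τ + s) (by omega) (by omega) i]

/-- The starting time is a stopping time: whether the run reaches a given state at `τ` is decided by
the noise before `τ`. -/
lemma Rules.phase_congr {e e' : ℕ → Fin M → ℝ} {n τ : ℕ} {A : Finset (Vec d)}
    (h : ∀ t < τ, ∀ i, e t i = e' t i) (hn : R.phase T D θ e n = (A, τ)) :
    R.phase T D θ e' n = (A, τ) := by
  induction n generalizing A τ with
  | zero => exact hn
  | succ n ih =>
    have h2 : (R.phase T D θ e n).2 + R.quota T (n + 1) (R.phase T D θ e n).1 = τ :=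
      congrArg Prod.snd hn
    have hprev := ih (fun t ht => h t (by omega)) (Prod.mk.eta (p := R.phase T D θ e n)).symm
    have hest : R.phaseEstimate T θ e' (n + 1) (R.phase T D θ e n).1 (R.phase T D θ e n).2 =
        R.phaseEstimate T θ e (n + 1) (R.phase T D θ e n).1 (R.phase T D θ e n).2 :=
      R.phaseEstimate_congr fun t _ ht i => (h t (by omega) i).symm
    rw [Prod.mk.eta] at hprev
    rw [← hn, Rules.phase, Rules.phase, hprev, hest]

end Locality

section Measurability

variable {d M T : ℕ} (R : Rules d M) {D : Finset (Vec d)} {θ : Vec d}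

/-- States range over a countable set, so they can be treated as discrete and fibres suffice. -/
lemma measurable_top_of_countable {α β : Type*} [MeasurableSpace α] {f : α → β} {S : Set β}
    (hS : S.Countable) (hf : ∀ x, f x ∈ S) (h : ∀ b ∈ S, MeasurableSet (f ⁻¹' {b})) :
    Measurable[_, ⊤] f := by
  intro U _
  have : f ⁻¹' U = ⋃ b ∈ S ∩ U, f ⁻¹' {b} := by
    ext x
    simp [hf x]
  rw [this]
  exact MeasurableSet.biUnion (hS.mono Set.inter_subset_left) fun b hb => h b hb.1

lemma Rules.measurable_inner_phaseEstimate (l : ℕ) (A : Finset (Vec d)) (τ : ℕ) (v : Vec d) :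
    Measurable fun e : ℕ → Fin M → ℝ => inner ℝ (R.phaseEstimate T θ e l A τ) v := by
  classical
  have hc : ∀ x, Measurable fun e : ℕ → Fin M → ℝ =>
      (R.pullCount T l A x : ℝ) * R.average T l A (R.phaseReport T θ e l A τ) x := by
    intro x
    by_cases hx : R.pullCount T l A x = 0
    · simp [hx]
    · simp only [R.pullCount_mul_average T l A θ _ τ hx]
      refine Finset.measurable_sum _ fun i _ => Finset.measurable_sum _ fun s _ => ?_
      split_ifs
      · fun_prop
      · exact measurable_const
  have h : ∀ e : ℕ → Fin M → ℝ, inner ℝ (R.phaseEstimate T θ e l A τ) v =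
      ∑ x : {x // x ∈ A},
        (R.pullCount T l A x.1 : ℝ) * R.average T l A (R.phaseReport T θ e l A τ) x.1 *
          inner ℝ ((Ring.inverse (gram A fun x => (R.pullCount T l A x : ℝ)) (inSpan A x) :
            actionSpan A) : Vec d) v := by
    intro e
    rw [Rules.phaseEstimate, Rules.estimate, map_sum]
    simp only [map_smul, Submodule.coe_sum, Submodule.coe_smul, sum_inner, inner_smul_left]
    rfl
  simp only [h]
  exact Finset.measurable_sum _ fun x _ => (hc x.1).mul_const _

lemma Rules.measurableSet_eliminate (l : ℕ) (A : Finset (Vec d)) (τ : ℕ) (A' : Finset (Vec d)) :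
    MeasurableSet {e : ℕ → Fin M → ℝ | eliminate l A (R.phaseEstimate T θ e l A τ) = A'} := by
  classical
  by_cases hA : A' ⊆ A
  · have h : {e : ℕ → Fin M → ℝ | eliminate l A (R.phaseEstimate T θ e l A τ) = A'} =
        ⋂ x ∈ A, {e | x ∈ A' ↔ ∀ b ∈ A,
          inner ℝ (R.phaseEstimate T θ e l A τ) (b - x) ≤ (2 : ℝ) ^ (-(l : ℤ) + 1)} := by
      ext e
      simp only [Set.mem_ofPred_eq, Set.mem_iInter, Finset.ext_iff, mem_eliminate]
      constructor
      · intro h x hx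
        rw [← h x, and_iff_right hx]
      · intro h x
        by_cases hx : x ∈ A
        · rw [h x hx, and_iff_right hx]
        · exact iff_of_false (fun h => hx h.1) (fun h => hx (hA h))
    rw [h]
    refine Finset.measurableSet_biInter _ fun x _ => ?_
    have hS : MeasurableSet {e : ℕ → Fin M → ℝ | ∀ b ∈ A,
        inner ℝ (R.phaseEstimate T θ e l A τ) (b - x) ≤ (2 : ℝ) ^ (-(l : ℤ) + 1)} := by
      have : {e : ℕ → Fin M → ℝ | ∀ b ∈ A,
          inner ℝ (R.phaseEstimate T θ e l A τ) (b - x) ≤ (2 : ℝ) ^ (-(l : ℤ) + 1)} =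
          ⋂ b ∈ A, {e | inner ℝ (R.phaseEstimate T θ e l A τ) (b - x) ≤
            (2 : ℝ) ^ (-(l : ℤ) + 1)} := by
        ext e; simp
      rw [this]
      exact Finset.measurableSet_biInter _ fun b _ =>
        measurableSet_le (R.measurable_inner_phaseEstimate l A τ _) measurable_const
    by_cases hx : x ∈ A'
    · simpa only [hx, true_iff] using hS
    · simp only [hx, false_iff]
      exact hS.compl
  · convert MeasurableSet.empty
    refine Set.eq_empty_of_forall_notMem fun e he => hA ?_
    rw [← he]
    exact fun x hx => (mem_eliminate.1 hx).1

/-- The possible states at the start of a phase. -/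
def states (D : Finset (Vec d)) : Set (Finset (Vec d) × ℕ) := {s | s.1 ⊆ D}

lemma countable_states : (states D).Countable := by
  have : states D = (D.powerset : Set (Finset (Vec d))) ×ˢ Set.univ := by
    ext s; simp [states]
  rw [this]
  exact D.powerset.countable_toSet.prod Set.countable_univ

lemma Rules.phase_mem_states (e : ℕ → Fin M → ℝ) (n : ℕ) :
    R.phase T D θ e n ∈ states D := by
  induction n with
  | zero => exact Finset.Subset.refl D
  | succ n ih => exact fun x hx => ih (mem_eliminate.1 hx).1

lemma Rules.measurable_phase (n : ℕ) :
    Measurable[_, ⊤] fun e : ℕ → Fin M → ℝ => R.phase T D θ e n := by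
  induction n with
  | zero => exact measurable_const
  | succ n ih =>
    refine measurable_top_of_countable countable_states (fun e => R.phase_mem_states e (n + 1)) ?_
    rintro ⟨A', τ'⟩ -
    have : (fun e : ℕ → Fin M → ℝ => R.phase T D θ e (n + 1)) ⁻¹' {(A', τ')} =
        ⋃ s ∈ states D, (fun e => R.phase T D θ e n) ⁻¹' {s} ∩
          ({e | eliminate (n + 1) s.1 (R.phaseEstimate T θ e (n + 1) s.1 s.2) = A'} ∩
            {_e | s.2 + R.quota T (n + 1) s.1 = τ'}) := by
      ext e
      simp only [Set.mem_preimage, Set.mem_singleton_iff, Set.mem_iUnion, Set.mem_inter_iff,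
        Set.mem_ofPred_eq]
      rw [Rules.phase, Prod.mk.injEq]
      constructor
      · intro h
        exact ⟨R.phase T D θ e n, R.phase_mem_states e n, rfl, h⟩
      · rintro ⟨s, -, hs, h⟩
        rw [hs]
        exact h
    rw [this]
    refine MeasurableSet.biUnion countable_states fun s _ => ?_
    exact (ih (MeasurableSpace.measurableSet_top : MeasurableSet[⊤] {s})).inter
      ((R.measurableSet_eliminate (n + 1) s.1 s.2 A').inter (MeasurableSet.const _))

lemma Rules.measurableSet_phase_eq (n : ℕ) (s : Finset (Vec d) × ℕ) :
    MeasurableSet {e : ℕ → Fin M → ℝ | R.phase T D θ e n = s} :=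
  R.measurable_phase n (MeasurableSpace.measurableSet_top : MeasurableSet[⊤] {s})

lemma Rules.measurable_phaseAt (t : ℕ) :
    Measurable fun e : ℕ → Fin M → ℝ => R.phaseAt T D θ e t :=
  measurable_findGreatest fun n _ =>
    R.measurable_phase (T := T) (D := D) (θ := θ) n
      (MeasurableSpace.measurableSet_top : MeasurableSet[⊤] {s : Finset (Vec d) × ℕ | s.2 ≤ t})

/-- The expected reward of agent `i` at time `t`, in terms of the current phase. -/
noncomputable def Rules.stateReward (T : ℕ) (θ : Vec d) (t : ℕ) (i : Fin M) (n : ℕ)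
    (s : Finset (Vec d) × ℕ) : ℝ :=
  inner ℝ (R.play (n + 1) s.1 i (R.assignment T (n + 1) s.1 i) (t - s.2)) θ

lemma Rules.measurable_inner_action (t : ℕ) (i : Fin M) :
    Measurable fun e : ℕ → Fin M → ℝ => inner ℝ (R.action T D θ e t i) θ := by
  -- The phase index is itself random; joint measurability in the countable index allows it to be
  -- substituted.
  have hF : Measurable fun p : ℕ × (ℕ → Fin M → ℝ) =>
      R.stateReward T θ t i p.1 (R.phase T D θ p.2 p.1) :=
    measurable_from_prod_countable_right fun n => by
      intro U _
      exact R.measurable_phase (T := T) (D := D) (θ := θ) n (MeasurableSpace.measurableSet_top :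
        MeasurableSet[⊤] (R.stateReward T θ t i n ⁻¹' U))
  have h := hF.comp ((R.measurable_phaseAt (T := T) (D := D) (θ := θ) t).prodMk measurable_id)
  simp only [Rules.action]
  simp only [Function.comp_def, id, Rules.stateReward] at h
  exact h

lemma Rules.measurable_regret (hD : D.Nonempty) :
    Measurable fun e : ℕ → Fin M → ℝ => R.regret T D hD θ e := by
  simp only [Rules.regret]
  exact Finset.measurable_sum _ fun t _ => Finset.measurable_sum _ fun i _ =>
    (R.measurable_inner_action t i).const_sub _

/-- The runs in which the estimate of phase `n + 1`, started in state `s`, is inaccurate. -/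
def Rules.inaccurate (T : ℕ) (θ : Vec d) (n : ℕ) (s : Finset (Vec d) × ℕ) :
    Set (ℕ → Fin M → ℝ) :=
  {e | ∃ x ∈ s.1,
    (1 / 2 : ℝ) ^ (n + 1) < |inner ℝ x (R.phaseEstimate T θ e (n + 1) s.1 s.2 - θ)|}

lemma Rules.measurableSet_inaccurate (n : ℕ) (s : Finset (Vec d) × ℕ) :
    MeasurableSet (R.inaccurate T θ n s) := by
  have : R.inaccurate T θ n s = ⋃ x ∈ s.1, {e | (1 / 2 : ℝ) ^ (n + 1) <
      |inner ℝ (R.phaseEstimate T θ e (n + 1) s.1 s.2) x - inner ℝ θ x|} := by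
    ext e
    simp only [Rules.inaccurate, Set.mem_ofPred_eq, Set.mem_iUnion, exists_prop]
    refine exists_congr fun x => and_congr_right fun _ => ?_
    rw [← inner_sub_left, real_inner_comm]
  rw [this]
  refine Finset.measurableSet_biUnion _ fun x _ => measurableSet_lt measurable_const ?_
  exact continuous_abs.measurable.comp
    ((R.measurable_inner_phaseEstimate (n + 1) s.1 s.2 x).sub_const _)

/-- On each piece the state is a constant `s`, so the second event concerns a fixed set of pulls and
becomes independent of the first. -/
lemma Rules.setOf_not_accurate (n : ℕ) :
    {e : ℕ → Fin M → ℝ | ¬ R.Accurate T D θ e n} =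
      ⋃ s ∈ states D, {e | R.phase T D θ e n = s} ∩ R.inaccurate T θ n s := by
  ext e
  simp only [Set.mem_ofPred_eq, Set.mem_iUnion, Set.mem_inter_iff, Rules.Accurate,
    Rules.inaccurate, not_forall, not_le, exists_prop]
  constructor
  · intro h
    exact ⟨_, R.phase_mem_states e n, rfl, h⟩
  · rintro ⟨s, -, rfl, h⟩
    exact h

lemma Rules.measurableSet_not_accurate (n : ℕ) :
    MeasurableSet {e : ℕ → Fin M → ℝ | ¬ R.Accurate T D θ e n} := by
  rw [R.setOf_not_accurate]
  exact MeasurableSet.biUnion countable_states fun s _ =>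
    (R.measurableSet_phase_eq n s).inter (R.measurableSet_inaccurate n s)

end Measurability

end DELB

/-! ### Concentration, independence and the expected regret. -/

namespace DELB

section Independence

variable {M : ℕ} {Ω : Type*} [MeasurableSpace Ω] {μ : Measure Ω}
  {η : ℕ → Fin M → Ω → ℝ}

/-- The noise with the values outside of `F` replaced by `0`. -/
def restrictNoise {M : ℕ} (F : Finset (ℕ × Fin M)) (e : ℕ → Fin M → ℝ) : ℕ → Fin M → ℝ :=
  fun t i => if (t, i) ∈ F then e t i else 0

/-- Padding with zeros keeps both blocks in the type of full noise sequences, so the run can be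
evaluated on either. -/
lemma indepFun_restrictNoise (hη : ∀ t i, Measurable (η t i))
    (hind : iIndepFun (fun (p : ℕ × Fin M) => η p.1 p.2) μ) {F F' : Finset (ℕ × Fin M)}
    (hF : Disjoint F F') :
    IndepFun (fun ω => restrictNoise F fun t i => η t i ω)
      (fun ω => restrictNoise F' fun t i => η t i ω) μ := by
  have h := hind.indepFun_finset F F' hF fun p => hη p.1 p.2
  let ext (F : Finset (ℕ × Fin M)) (p : F → ℝ) : ℕ → Fin M → ℝ :=
    fun t i => if h : (t, i) ∈ F then p ⟨(t, i), h⟩ else 0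
  have hext : ∀ F, Measurable (ext F) := by
    intro F
    refine measurable_pi_lambda _ fun t => measurable_pi_lambda _ fun i => ?_
    by_cases h : (t, i) ∈ F
    · simp only [ext, h, dite_true]
      exact measurable_pi_apply _
    · simp only [ext, h, dite_false]
      exact measurable_const
  have hcut : ∀ F : Finset (ℕ × Fin M), (fun ω => restrictNoise F fun t i => η t i ω) =
      ext F ∘ fun ω (p : F) => η p.1.1 p.1.2 ω := by
    intro F
    funext ω t i
    by_cases h : (t, i) ∈ F <;> simp [restrictNoise, ext, h]
  rw [hcut, hcut]
  exact h.comp (hext F) (hext F')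

variable [IsProbabilityMeasure μ]

/-- Hoeffding's inequality for a weighted sum of bounded centred noise variables. -/
lemma measureReal_lt_sum_le {κ : Type*} [Fintype κ] {f : κ → ℕ × Fin M}
    (hf : Function.Injective f) (hη : ∀ t i, Measurable (η t i))
    (hind : iIndepFun (fun (p : ℕ × Fin M) => η p.1 p.2) μ)
    (hb : ∀ t i, ∀ᵐ ω ∂μ, η t i ω ∈ Set.Icc (-1 : ℝ) 1) (h0 : ∀ t i, ∫ ω, η t i ω ∂μ = 0)
    (a : κ → ℝ) {ε : ℝ} (hε : 0 ≤ ε) :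
    μ.real {ω | ε * √(∑ j, a j ^ 2) < ∑ j, a j * η (f j).1 (f j).2 ω} ≤ Real.exp (-ε ^ 2 / 2) := by
  have hv0 : 0 ≤ ∑ j, a j ^ 2 := Finset.sum_nonneg fun j _ => sq_nonneg _
  rcases hv0.eq_or_lt with hv | hv
  · have ha : ∀ j, a j = 0 := fun j => by
      have := (Finset.sum_eq_zero_iff_of_nonneg fun j _ => sq_nonneg (a j)).1 hv.symm j
        (Finset.mem_univ j)
      simpa using this
    simp only [ha]
    simp [Real.exp_nonneg]
  · have hX : iIndepFun (fun j ω => a j * η (f j).1 (f j).2 ω) μ :=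
      (hind.precomp hf).comp (fun j x => a j * x) fun j => measurable_const_mul _
    have hsub : ∀ j, HasSubgaussianMGF (fun ω => a j * η (f j).1 (f j).2 ω)
        (Real.toNNReal (a j ^ 2)) μ := by
      intro j
      have h := (hasSubgaussianMGF_of_mem_Icc_of_integral_eq_zero (hη (f j).1 (f j).2).aemeasurable
        (hb _ _) (h0 _ _)).const_mul (a j)
      -- Hoeffding's lemma on `[-1, 1]` gives variance proxy `1`.
      have h1 : ((‖(1 : ℝ) - -1‖₊ / 2) ^ 2 : NNReal) = 1 := by
        ext
        norm_num
      rw [h1] at h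
      convert h using 1
      ext
      rw [Real.coe_toNNReal _ (sq_nonneg _)]
      exact (mul_one (a j ^ 2)).symm
    have h := HasSubgaussianMGF.measure_sum_ge_le_of_iIndepFun hX
      (s := Finset.univ) (fun j _ => hsub j) (ε := ε * √(∑ j, a j ^ 2)) (by positivity)
    have hc : ((∑ j, Real.toNNReal (a j ^ 2) : NNReal) : ℝ) = ∑ j, a j ^ 2 := by
      push_cast
      exact Finset.sum_congr rfl fun j _ => Real.coe_toNNReal _ (sq_nonneg _)
    rw [hc, mul_pow, Real.sq_sqrt hv0] at h
    have he : -(ε ^ 2 * ∑ j, a j ^ 2) / (2 * ∑ j, a j ^ 2) = -ε ^ 2 / 2 := by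
      field_simp
    rw [he] at h
    refine (measureReal_mono ?_).trans h
    intro ω hω
    rw [Set.mem_ofPred_eq] at hω ⊢
    exact hω.le

lemma measureReal_lt_abs_sum_le {κ : Type*} [Fintype κ] {f : κ → ℕ × Fin M}
    (hf : Function.Injective f) (hη : ∀ t i, Measurable (η t i))
    (hind : iIndepFun (fun (p : ℕ × Fin M) => η p.1 p.2) μ)
    (hb : ∀ t i, ∀ᵐ ω ∂μ, η t i ω ∈ Set.Icc (-1 : ℝ) 1) (h0 : ∀ t i, ∫ ω, η t i ω ∂μ = 0)
    (a : κ → ℝ) {ε : ℝ} (hε : 0 ≤ ε) :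
    μ.real {ω | ε * √(∑ j, a j ^ 2) < |∑ j, a j * η (f j).1 (f j).2 ω|} ≤
      2 * Real.exp (-ε ^ 2 / 2) := by
  have h1 := measureReal_lt_sum_le hf hη hind hb h0 a hε
  have h2 := measureReal_lt_sum_le hf hη hind hb h0 (fun j => -a j) hε
  simp only [neg_sq, neg_mul, Finset.sum_neg_distrib] at h2
  refine (measureReal_mono (fun ω hω => ?_)).trans ((measureReal_union_le _ _).trans
    ((add_le_add h1 h2).trans (two_mul _).ge))
  rw [Set.mem_ofPred_eq, lt_abs] at hω
  exact hω

end Independence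

section Probability

variable {d M T : ℕ} {R : Rules d M} {D : Finset (Vec d)} {θ : Vec d}
  {Ω : Type*} [MeasurableSpace Ω] {μ : Measure Ω}
  {η : ℕ → Fin M → Ω → ℝ}

lemma measurable_noise (hη : ∀ t i, Measurable (η t i)) : Measurable fun ω t i => η t i ω :=
  measurable_pi_lambda _ fun t => measurable_pi_lambda _ fun i => hη t i

/-- The state at the start of a phase is independent of the noise during the phase. -/
lemma Rules.indep_state_inaccurate (R : Rules d M) (hη : ∀ t i, Measurable (η t i))
    (hind : iIndepFun (fun (p : ℕ × Fin M) => η p.1 p.2) μ) (n : ℕ) (s : Finset (Vec d) × ℕ) :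
    μ ({ω | R.phase T D θ (fun t i => η t i ω) n = s} ∩
        {ω | (fun t i => η t i ω) ∈ R.inaccurate T θ n s}) =
      μ {ω | R.phase T D θ (fun t i => η t i ω) n = s} *
        μ {ω | (fun t i => η t i ω) ∈ R.inaccurate T θ n s} := by
  set F : Finset (ℕ × Fin M) := Finset.range s.2 ×ˢ Finset.univ
  set F' : Finset (ℕ × Fin M) := Finset.Ico s.2 (s.2 + R.quota T (n + 1) s.1) ×ˢ Finset.univ
  have hF : Disjoint F F' := by
    rw [Finset.disjoint_left]
    intro p hp hp'
    simp only [F, F', Finset.mem_product, Finset.mem_range, Finset.mem_Ico] at hp hp'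
    omega
  have h := (indepFun_restrictNoise hη hind hF).measure_inter_preimage_eq_mul _ _
    (R.measurableSet_phase_eq (T := T) (D := D) (θ := θ) n s)
    (R.measurableSet_inaccurate (T := T) (θ := θ) n s)
  have hE : (fun ω => restrictNoise F fun t i => η t i ω) ⁻¹'
      {e | R.phase T D θ e n = s} = {ω | R.phase T D θ (fun t i => η t i ω) n = s} := by
    ext ω
    have hag : ∀ t < s.2, ∀ i, restrictNoise F (fun t i => η t i ω) t i = η t i ω := by
      intro t ht i
      simp [restrictNoise, F, ht]
    exact ⟨fun h => R.phase_congr hag h, fun h => R.phase_congr (fun t ht i => (hag t ht i).symm) h⟩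
  have hB : (fun ω => restrictNoise F' fun t i => η t i ω) ⁻¹' R.inaccurate T θ n s =
      {ω | (fun t i => η t i ω) ∈ R.inaccurate T θ n s} := by
    ext ω
    have hest : R.phaseEstimate T θ (restrictNoise F' fun t i => η t i ω) (n + 1) s.1 s.2 =
        R.phaseEstimate T θ (fun t i => η t i ω) (n + 1) s.1 s.2 := by
      refine R.phaseEstimate_congr fun t h1 h2 i => ?_
      simp [restrictNoise, F', h1, h2]
    simp only [Set.mem_preimage, Rules.inaccurate, Set.mem_ofPred_eq, hest]
  rwa [hE, hB] at h

variable [IsProbabilityMeasure μ]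

/-- A phase that starts in a given state is inaccurate with small probability. -/
lemma Rules.Valid.measureReal_inaccurate_le (hR : R.Valid T D) (hd : 3 ≤ d) (hM : 1 ≤ M)
    (hT : 3 ≤ T) (hη : ∀ t i, Measurable (η t i))
    (hind : iIndepFun (fun (p : ℕ × Fin M) => η p.1 p.2) μ)
    (hb : ∀ t i, ∀ᵐ ω ∂μ, η t i ω ∈ Set.Icc (-1 : ℝ) 1) (h0 : ∀ t i, ∫ ω, η t i ω ∂μ = 0)
    (n : ℕ) {s : Finset (Vec d) × ℕ} (hs : s ∈ states D) :
    μ.real {ω | (fun t i => η t i ω) ∈ R.inaccurate T θ n s} ≤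
      2 * d * Real.exp (-150 * Real.log ((M : ℝ) * T)) := by
  have hK := one_le_log_mul hM hT
  set K := Real.log ((M : ℝ) * T) with hKdef
  rcases s.1.eq_empty_or_nonempty with hne | hne
  · have : {ω | (fun t i => η t i ω) ∈ R.inaccurate T θ n s} = ∅ := by
      simp [Rules.inaccurate, hne]
    rw [this, measureReal_empty]
    positivity
  obtain ⟨a, ha⟩ := hR.exists_estimate_error (Nat.le_add_left 1 n) hs hne (by omega) hM
    (by linarith)
  have hk : (Module.finrank ℝ (actionSpan s.1) : ℝ) ≤ d := by
    have : Module.finrank ℝ (actionSpan s.1) ≤ d := by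
      simpa using Submodule.finrank_le (actionSpan s.1)
    exact_mod_cast this
  let f : R.Slot T (n + 1) s.1 → ℕ × Fin M := fun j => (s.2 + j.2, j.1)
  have hf : Function.Injective f := by
    rintro ⟨i, x⟩ ⟨j, y⟩ h
    simp only [f, Prod.mk.injEq] at h
    obtain ⟨h1, rfl⟩ := h
    have : x = y := Fin.ext (by omega)
    rw [this]
  -- An inaccurate estimate forces one of the at most `d` coordinates beyond its threshold; each
  -- does so with probability at most `2 exp (-150 K)`.
  have hsub : {ω | (fun t i => η t i ω) ∈ R.inaccurate T θ n s} ⊆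
      ⋃ i, {ω | √(300 * K) * √(∑ j, a i j ^ 2) < |∑ j, a i j * η (f j).1 (f j).2 ω|} := by
    intro ω hω
    by_contra hnot
    simp only [Set.mem_iUnion, Set.mem_ofPred_eq, not_exists, not_lt] at hnot
    obtain ⟨x, hx, hlt⟩ := hω
    exact absurd (ha θ (fun t i => η t i ω) s.2 hnot x hx) (not_le.2 hlt)
  refine (measureReal_mono hsub).trans ((measureReal_iUnion_fintype_le _).trans ?_)
  refine (Finset.sum_le_sum fun i _ =>
    measureReal_lt_abs_sum_le hf hη hind hb h0 (a i) (Real.sqrt_nonneg _)).trans ?_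
  rw [Real.sq_sqrt (by positivity), Finset.sum_const, Finset.card_univ, Fintype.card_fin,
    nsmul_eq_mul, show -(300 * K) / 2 = -150 * K by ring]
  have := Real.exp_nonneg (-150 * K)
  nlinarith

/-- The bound for a fixed state is averaged over the disjoint events that the phase starts in that
state, so the number of states does not enter. -/
lemma Rules.Valid.measureReal_not_accurate_le (hR : R.Valid T D) (hd : 3 ≤ d) (hM : 1 ≤ M)
    (hT : 3 ≤ T) (hη : ∀ t i, Measurable (η t i))
    (hind : iIndepFun (fun (p : ℕ × Fin M) => η p.1 p.2) μ)
    (hb : ∀ t i, ∀ᵐ ω ∂μ, η t i ω ∈ Set.Icc (-1 : ℝ) 1) (h0 : ∀ t i, ∫ ω, η t i ω ∂μ = 0)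
    (n : ℕ) :
    μ.real {ω | ¬ R.Accurate T D θ (fun t i => η t i ω) n} ≤
      2 * d * Real.exp (-150 * Real.log ((M : ℝ) * T)) := by
  set δ := 2 * d * Real.exp (-150 * Real.log ((M : ℝ) * T))
  have hδ : 0 ≤ δ := by positivity
  have hc : Countable (states D) := countable_states.to_subtype
  let E : states D → Set Ω := fun s => {ω | R.phase T D θ (fun t i => η t i ω) n = s.1}
  let B : states D → Set Ω := fun s => {ω | (fun t i => η t i ω) ∈ R.inaccurate T θ n s.1}
  have hunion : {ω | ¬ R.Accurate T D θ (fun t i => η t i ω) n} = ⋃ s : states D, E s ∩ B s := by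
    have h := congrArg (fun S => (fun ω t i => η t i ω) ⁻¹' S)
      (R.setOf_not_accurate (T := T) (D := D) (θ := θ) n)
    simp only [Set.preimage_iUnion, Set.preimage_inter] at h
    rw [Set.biUnion_eq_iUnion] at h
    exact h
  have hEmeas : ∀ s, MeasurableSet (E s) := fun s =>
    measurable_noise hη (R.measurableSet_phase_eq n s.1)
  have hEdisj : Pairwise (Function.onFun Disjoint E) := by
    intro s s' hss
    rw [Function.onFun, Set.disjoint_left]
    intro ω h h'
    exact hss (Subtype.ext (h.symm.trans h'))
  have hBle : ∀ s, μ (B s) ≤ ENNReal.ofReal δ := by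
    intro s
    rw [← ofReal_measureReal]
    exact ENNReal.ofReal_le_ofReal
      (hR.measureReal_inaccurate_le hd hM hT hη hind hb h0 n s.2)
  have hle : μ {ω | ¬ R.Accurate T D θ (fun t i => η t i ω) n} ≤ ENNReal.ofReal δ := by
    rw [hunion]
    calc μ (⋃ s, E s ∩ B s) ≤ ∑' s, μ (E s ∩ B s) := measure_iUnion_le _
      _ = ∑' s, μ (E s) * μ (B s) :=
        tsum_congr fun s => R.indep_state_inaccurate hη hind n s.1
      _ ≤ ∑' s, μ (E s) * ENNReal.ofReal δ := ENNReal.tsum_le_tsum fun s => by gcongr; exact hBle s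
      _ = μ (⋃ s, E s) * ENNReal.ofReal δ := by
        rw [ENNReal.tsum_mul_right, measure_iUnion hEdisj hEmeas]
      _ ≤ 1 * ENNReal.ofReal δ := by gcongr; exact prob_le_one
      _ = ENNReal.ofReal δ := one_mul _
  exact ENNReal.toReal_le_of_le_ofReal hδ hle

/-- The expected regret of the protocol. -/
theorem Rules.Valid.integral_regret_le (hR : R.Valid T D) (hD : D.Nonempty)
    (hDn : ∀ x ∈ D, ‖x‖ ≤ 1) (hθ : ‖θ‖ ≤ 1) (hd : 3 ≤ d) (hM : 1 ≤ M) (hMT : M < T) (hT : 3 ≤ T)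
    (hη : ∀ t i, Measurable (η t i))
    (hind : iIndepFun (fun (p : ℕ × Fin M) => η p.1 p.2) μ)
    (hb : ∀ t i, ∀ᵐ ω ∂μ, η t i ω ∈ Set.Icc (-1 : ℝ) 1) (h0 : ∀ t i, ∫ ω, η t i ω ∂μ = 0) :
    Integrable (fun ω => R.regret T D hD θ (fun t i => η t i ω)) μ ∧
      ∫ ω, R.regret T D hD θ (fun t i => η t i ω) ∂μ ≤
        1028 * (d * √((T : ℝ) * M * Real.log T)) := by
  have hmeas : Measurable fun ω => R.regret T D hD θ (fun t i => η t i ω) :=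
    (R.measurable_regret hD).comp (measurable_noise hη)
  have hint : Integrable (fun ω => R.regret T D hD θ (fun t i => η t i ω)) μ := by
    refine Integrable.of_bound hmeas.aestronglyMeasurable (2 * ((M : ℝ) * T))
      (Filter.Eventually.of_forall fun ω => ?_)
    have h := hR.regret_bounds (e := fun t i => η t i ω) hD hDn hθ
    rw [Real.norm_of_nonneg h.1]
    exact h.2
  refine ⟨hint, ?_⟩
  have hK := one_le_log_mul hM hT
  have hL := one_le_log hT
  have hM1 : (1 : ℝ) ≤ M := by exact_mod_cast hM
  have hT1 : (1 : ℝ) ≤ T := by exact_mod_cast (by omega : 1 ≤ T)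
  set K := Real.log ((M : ℝ) * T) with hKdef
  set Q := (d : ℝ) * √((T : ℝ) * M * Real.log T) with hQ
  have hQ0 : 0 ≤ Q := by positivity
  -- Phase indices below `T` suffice, since `phaseAt` at time `t` is at most `t`.
  set bad : Set Ω := ⋃ n ∈ Finset.range T, {ω | ¬ R.Accurate T D θ (fun t i => η t i ω) n}
    with hbad
  have hbadm : MeasurableSet bad := Finset.measurableSet_biUnion _ fun n _ =>
    measurable_noise hη (R.measurableSet_not_accurate n)
  have hbadp : μ.real bad ≤ T * (2 * d * Real.exp (-150 * K)) := by
    refine (measureReal_biUnion_finset_le _ _).trans ((Finset.sum_le_sum fun n _ =>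
      hR.measureReal_not_accurate_le hd hM hT hη hind hb h0 n).trans ?_)
    simp [hKdef]
  have hpt : ∀ ω, R.regret T D hD θ (fun t i => η t i ω) ≤
      1024 * Q + bad.indicator (fun _ => 2 * ((M : ℝ) * T)) ω := by
    intro ω
    by_cases hω : ω ∈ bad
    · rw [Set.indicator_of_mem hω]
      have h := (hR.regret_bounds (e := fun t i => η t i ω) hD hDn hθ).2
      linarith
    · rw [Set.indicator_of_notMem hω, add_zero]
      refine hR.regret_le hD hDn hθ hd hM hMT hT fun n hn => ?_
      by_contra h
      exact hω (Set.mem_biUnion (Finset.mem_coe.2 (Finset.mem_range.2 hn)) h)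
  have hI : Integrable (bad.indicator fun _ : Ω => 2 * ((M : ℝ) * T)) μ :=
    (integrable_const _).indicator hbadm
  have hle := integral_mono hint ((integrable_const (1024 * Q)).add hI) hpt
  simp only [Pi.add_apply] at hle
  rw [integral_add (integrable_const _) hI, integral_const, probReal_univ, one_smul,
    integral_indicator_const _ hbadm, smul_eq_mul] at hle
  have hMT0 : 0 < (M : ℝ) * T := by positivity
  have hexp : Real.exp (-150 * K) * ((M : ℝ) * T) ^ 2 ≤ 1 := by
    have : ((M : ℝ) * T) ^ 2 = Real.exp (2 * K) := by
      rw [two_mul, Real.exp_add, hKdef, Real.exp_log hMT0, sq]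
    rw [this, ← Real.exp_add]
    exact Real.exp_le_one_iff.2 (by linarith)
  have hdQ : (d : ℝ) ≤ Q := by
    rw [hQ]
    refine le_mul_of_one_le_right (Nat.cast_nonneg d) (Real.one_le_sqrt.2 ?_)
    calc (1 : ℝ) = 1 * 1 * 1 := by norm_num
      _ ≤ T * M * Real.log T := by gcongr
  -- On the bad event the trivial bound `2MT` is used. Its contribution `4d` is at most `4Q`, which
  -- raises 1024 to 1028.
  have hfail : μ.real bad * (2 * ((M : ℝ) * T)) ≤ 4 * d := by
    calc μ.real bad * (2 * ((M : ℝ) * T))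
        ≤ T * (2 * d * Real.exp (-150 * K)) * (2 * ((M : ℝ) * T)) := by gcongr
      _ = 4 * d * (Real.exp (-150 * K) * (1 * T * (M * T))) := by ring
      _ ≤ 4 * d * (Real.exp (-150 * K) * (M * T * (M * T))) := by gcongr
      _ = 4 * d * (Real.exp (-150 * K) * ((M : ℝ) * T) ^ 2) := by ring
      _ ≤ 4 * d * 1 := by gcongr
      _ = 4 * d := mul_one _
  linarith

end Probability

end DELB

theorem theorem3 :
    ∃ C : ℝ, 0 < C ∧
      ∀ (d M T : ℕ), 3 ≤ d → 1 ≤ M → max M 2 < T →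
      ∀ (D : Finset (DELB.Vec d)) (hD : D.Nonempty), (∀ x ∈ D, ‖x‖ ≤ 1) →
        (∃ R : DELB.Rules d M, R.Valid T D) ∧
        ∀ R : DELB.Rules d M, R.Valid T D →
        ∀ (θ : DELB.Vec d), ‖θ‖ ≤ 1 →
        ∀ (Ω : Type*) [MeasurableSpace Ω] (μ : Measure Ω) [IsProbabilityMeasure μ]
          (η : ℕ → Fin M → Ω → ℝ),
          (∀ t i, Measurable (η t i)) →
          iIndepFun (fun (p : ℕ × Fin M) => η p.1 p.2) μ →
          (∀ t i, ∀ᵐ ω ∂μ, η t i ω ∈ Set.Icc (-1 : ℝ) 1) →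
          (∀ t i, ∫ ω, η t i ω ∂μ = 0) →
            Integrable (fun ω => R.regret T D hD θ (fun t i => η t i ω)) μ ∧
            ∫ ω, R.regret T D hD θ (fun t i => η t i ω) ∂μ
              ≤ C * ((d : ℝ) * Real.sqrt ((T : ℝ) * (M : ℝ) * Real.log (T : ℝ))) ∧
            ∀ ω, (R.commCost T D θ (fun t i => η t i ω) : ℝ)
              ≤ C * (((M : ℝ) * (d : ℝ) + (d : ℝ) * Real.log (Real.log (d : ℝ)))
                  * Real.log (T : ℝ)) := by
  refine ⟨1028, by norm_num, fun d M T hd hM hMT D hD hDn =>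
    ⟨DELB.exists_valid_rules hd D, ?_⟩⟩
  intro R hR θ hθ Ω _ μ _ η hη hind hb h0
  have hMT' : M < T := (le_max_left _ _).trans_lt hMT
  have hT : 3 ≤ T := (le_max_right M 2).trans_lt hMT
  have hreg := hR.integral_regret_le hD hDn hθ hd hM hMT' hT hη hind hb h0
  refine ⟨hreg.1, hreg.2, fun ω => (hR.commCost_le hD hd hM hMT' hT).trans ?_⟩
  have hL := DELB.one_le_log hT
  have hll := DELB.one_div_le_log_log hd
  gcongr
  norm_num
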